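/- Let $f:\mathbb{R}^n\to\mathbb{R}$ and $g=(g_1,\dots,g_m):\mathbb{R}^n\to\mathbb{R}^m$, let $C=\{x : g_i(x)\ge 0 \text{ for all } i\}$ and $I_x=\{i : g_i(x)\le 0\}$, and let $\alpha>0$, $\beta\ge 0$, $\delta>0$, $\epsilon\in[0,1)$ be constants. Put $\gamma_i(x,u)=\nabla g_i(x)^{\top}u+\alpha g_i(x)$. A trajectory consists of functions $x,u$ on $[0,\infty)$ with the following properties. The function $x$ is locally absolutely continuous with $\mathrm{d}x=u\,\mathrm{d}t$. The velocity $u$ is of locally bounded variation without singular part, has one-sided limits $u(t)^\pm$, and may jump at $t=0$ from its initial value $u(0)^-$. Finally, the measure-differential inclusion $$\mathrm{d}u+2\delta u\,\mathrm{d}t+\nabla f(x+\beta u)\,\mathrm{d}t=\sum_{i\in I_x}\nabla g_i(x)\,\mathrm{d}\lambda_i,\qquad \gamma_i(x,u^+)+\epsilon\,\gamma_i(x,u^-)\in N_{\mathbb{R}_{\le 0}}(-\mathrm{d}\lambda_i),\quad i\in I_x,$$ holds for some multipliers $\mathrm{d}\lambda_i=\lambda_i\,\mathrm{d}t+\Lambda_i\,\mathrm{d}\eta$.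 Here $\mathrm{d}\eta$ is the atomic part, $\lambda_i$ is locally integrable, $\Lambda_i$ is summable on compact intervals, and the inclusion is understood for the densities with respect to $\mathrm{d}t$ (almost everywhere) and for the atoms (at every instant). Assume that $f$ is $1$-smooth (differentiable with $1$-Lipschitz gradient), that each $g_i$ is continuously differentiable, that $C$ is compact, that the Mangasarian-Fromovitz constraint qualification holds on $C$ (for each $x\in C$ there is $w$ with $\nabla g_i(x)^{\top}w>0$ for all $i\in I_x$), and that either $f$ is convex or $2\delta-\beta>0$. Then: 1. For every trajectory with $x(0)\in C$, the distance of $x(t)$ to the set of Karush-Kuhn-Tucker points of $\min f(x)$ subject to $g(x)\ge 0$ tends to $0$ as $t\to\infty$, and $u(t)\to 0$ (that is, $u(t)^\pm\to 0$). 2. Let $x^*$ be an isolated local minimum, i.e. a local minimum of $f$ on $C$ that has a neighborhood containing no other Karush-Kuhn-Tucker point. Then $(x^*,0)$ is an asymptotically stable equilibrium in the sense of Lyapunov: it is an equilibrium, and it is stable and attractive with respect to the trajectories with $x(0)\in C$ and $(x(0),u(0)^-)$ close to $(x^*,0)$. 3. If $x^*$ is any strict local minimum of $f$ on $C$, then $(x^*,0)$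 is an equilibrium and is stable in the sense of Lyapunov. -/

import Mathlib

open Set Filter Topology MeasureTheory

noncomputable section

namespace AccFlow

variable {n m : ℕ}

/-- The Euclidean space `ℝⁿ`. -/
abbrev Vec (n : ℕ) : Type := EuclideanSpace ℝ (Fin n)

/-- The feasible set `C = {x | g(x) ≥ 0}`. -/
def feasibleSet (g : Fin m → Vec n → ℝ) : Set (Vec n) := {x | ∀ i, 0 ≤ g i x}

/-- The index set `I_x = {i | g_i(x) ≤ 0}` of active (or violated) constraints. -/
def activeSet (g : Fin m → Vec n → ℝ) (x : Vec n) : Finset (Fin m) :=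
  open Classical in Finset.univ.filter (fun i => g i x ≤ 0)

/-- `f` is `1`-smooth: it is differentiable and its gradient is Lipschitz with constant one. -/
def OneSmooth (f : Vec n → ℝ) : Prop :=
  Differentiable ℝ f ∧ LipschitzWith 1 (gradient f)

/-- The Mangasarian-Fromovitz constraint qualification at every feasible point. -/
def MFCQ (g : Fin m → Vec n → ℝ) : Prop :=
  ∀ x ∈ feasibleSet g, ∃ w : Vec n, ∀ i ∈ activeSet g x, 0 < inner ℝ (gradient (g i) x) w

/-- The set of stationary (Karush-Kuhn-Tucker) points of `min f(x)` subject to `g(x) ≥ 0`. -/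
def stationarySet (f : Vec n → ℝ) (g : Fin m → Vec n → ℝ) : Set (Vec n) :=
  {x | x ∈ feasibleSet g ∧ ∃ l : Fin m → ℝ, (∀ i, 0 ≤ l i) ∧ (∀ i, l i * g i x = 0) ∧
    gradient f x = ∑ i, l i • gradient (g i) x}

/-- The normal cone `N_K(p)` of a (convex) set `K ⊆ ℝ` at `p`; it is empty if `p ∉ K`. -/
def normalCone (K : Set ℝ) (p : ℝ) : Set ℝ :=
  {w | p ∈ K ∧ ∀ y ∈ K, w * (y - p) ≤ 0}

/-- The velocity `γ_i(x,u) = ∇g_i(x)ᵀ u + α g_i(x)` associated with a constraint function. -/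
def gam (α : ℝ) (gi : Vec n → ℝ) (x u : Vec n) : ℝ :=
  inner ℝ (gradient gi x) u + α * gi x

/-- `um` and `up` are the one-sided limits `u(t)⁻`, `u(t)⁺`, `t ≥ 0`, of a function of locally
bounded variation without singular part: the differential measure is
`du = a dt + (u⁺ - u⁻) dη`, with `a` locally integrable and with (at most countably many) jumps that
are summable on compact intervals. The value `um 0 = u(0)⁻` is the initial value; a jump at the time
`0` is allowed. -/
structure IsNonsingularBV (um up a : ℝ → Vec n) : Prop where
  integrable : ∀ t, 0 ≤ t → IntervalIntegrable a volume 0 t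
  summable : ∀ t, 0 ≤ t → Summable (fun s : Icc (0 : ℝ) t => ‖up s - um s‖)
  right : ∀ t, 0 ≤ t →
    up t = um 0 + (∫ s in (0 : ℝ)..t, a s) + ∑' s : Icc (0 : ℝ) t, (up s - um s)
  left : ∀ t, 0 ≤ t →
    um t = um 0 + (∫ s in (0 : ℝ)..t, a s) + ∑' s : Ico (0 : ℝ) t, (up s - um s)

/-- Trajectories `(x, u)` on `[0, ∞)` of the measure-differential inclusion
`du + 2 δ u dt + ∇f(x + β u) dt = ∑_{i ∈ I_x} ∇g_i(x) dλ_i`,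
`γ_i⁺ + ε γ_i⁻ ∈ N_{ℝ≤0}(-dλ_i)` for `i ∈ I_x`, with `dx = u dt`.
The velocity is given by its one-sided limits `um t = u(t)⁻` and `up t = u(t)⁺` (which coincide
for almost every `t`). The multipliers are `dλ_i = l_i dt + L_i dη`, and the inclusion is imposed on
the densities with respect to `dt` (almost everywhere) and on the atoms (at every instant). -/
def IsTrajectory (f : Vec n → ℝ) (g : Fin m → Vec n → ℝ) (α β δ ε : ℝ)
    (x um up : ℝ → Vec n) : Prop :=
  (∀ t, 0 ≤ t → IntervalIntegrable up volume 0 t ∧ x t = x 0 + ∫ s in (0 : ℝ)..t, up s) ∧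
  ∃ (a : ℝ → Vec n) (l L : Fin m → ℝ → ℝ),
    IsNonsingularBV um up a ∧
    (∀ i t, 0 ≤ t → IntervalIntegrable (l i) volume 0 t) ∧
    (∀ i t, 0 ≤ t → Summable (fun s : Icc (0 : ℝ) t => L i s)) ∧
    (∀ᵐ t ∂(volume.restrict (Ici (0 : ℝ))),
      a t + (2 * δ) • up t + gradient f (x t + β • up t)
        = ∑ i ∈ activeSet g (x t), l i t • gradient (g i) (x t)) ∧
    (∀ᵐ t ∂(volume.restrict (Ici (0 : ℝ))), ∀ i ∈ activeSet g (x t),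
      gam α (g i) (x t) (up t) + ε * gam α (g i) (x t) (um t) ∈ normalCone (Iic 0) (-(l i t))) ∧
    (∀ t, 0 ≤ t →
      up t - um t = ∑ i ∈ activeSet g (x t), L i t • gradient (g i) (x t)) ∧
    (∀ t, 0 ≤ t → ∀ i ∈ activeSet g (x t),
      gam α (g i) (x t) (up t) + ε * gam α (g i) (x t) (um t) ∈ normalCone (Iic 0) (-(L i t)))

/-- `(p, 0)` is an equilibrium: `x ≡ p`, `u ≡ 0` is a trajectory. -/
def IsEquilibrium (f : Vec n → ℝ) (g : Fin m → Vec n → ℝ) (α β δ ε : ℝ) (p : Vec n) : Prop :=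
  IsTrajectory f g α β δ ε (fun _ => p) (fun _ => 0) (fun _ => 0)

/-- Lyapunov stability of `(p, 0)` with respect to the trajectories that start in the feasible
set. -/
def LyapunovStable (f : Vec n → ℝ) (g : Fin m → Vec n → ℝ) (α β δ ε : ℝ) (p : Vec n) : Prop :=
  ∀ r > 0, ∃ d > 0, ∀ x um up : ℝ → Vec n, IsTrajectory f g α β δ ε x um up →
    x 0 ∈ feasibleSet g → ‖x 0 - p‖ < d → ‖um 0‖ < d →
    ∀ t, 0 ≤ t → ‖x t - p‖ < r ∧ ‖um t‖ < r ∧ ‖up t‖ < r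

/-- Local attractivity of `(p, 0)` with respect to the trajectories that start in the feasible
set. -/
def Attractive (f : Vec n → ℝ) (g : Fin m → Vec n → ℝ) (α β δ ε : ℝ) (p : Vec n) : Prop :=
  ∃ d > 0, ∀ x um up : ℝ → Vec n, IsTrajectory f g α β δ ε x um up →
    x 0 ∈ feasibleSet g → ‖x 0 - p‖ < d → ‖um 0‖ < d →
    Tendsto x atTop (𝓝 p) ∧ Tendsto um atTop (𝓝 0) ∧ Tendsto up atTop (𝓝 0)

/-- `(p, 0)` is an asymptotically stable equilibrium in the sense of Lyapunov. -/
def AsymptoticallyStable (f : Vec n → ℝ) (g : Fin m → Vec n → ℝ) (α β δ ε : ℝ)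
    (p : Vec n) : Prop :=
  IsEquilibrium f g α β δ ε p ∧ LyapunovStable f g α β δ ε p ∧ Attractive f g α β δ ε p

/-- `p` is a strict local minimum of `f` on the feasible set. -/
def IsStrictLocalMin (f : Vec n → ℝ) (g : Fin m → Vec n → ℝ) (p : Vec n) : Prop :=
  p ∈ feasibleSet g ∧ ∀ᶠ y in 𝓝[feasibleSet g] p, y ≠ p → f p < f y

/-- `p` is an isolated local minimum: a local minimum of `f` on the feasible set such that no other
stationary point lies in some neighborhood of `p`. -/
def IsIsolatedLocalMin (f : Vec n → ℝ) (g : Fin m → Vec n → ℝ) (p : Vec n) : Prop :=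
  p ∈ feasibleSet g ∧ IsLocalMinOn f (feasibleSet g) p ∧
    ∀ᶠ y in 𝓝 p, y ∈ stationarySet f g → y = p

end AccFlow

end

open AccFlow

/-! The argument is LaSalle's, with the energy `‖u‖ ^ 2 / 2 + f x` as Lyapunov function. A violated
constraint satisfies `γ_i ≥ 0` almost everywhere, which makes `g_i` increase, so trajectories stay
in `C` (`mem_feasibleSet`). On `C` active constraints vanish. Complementarity then says that the
reaction forces do no work between impacts and that impacts do not raise the kinetic energy. With
the damping constant `c > 0` from convexity or from `2 * δ - β > 0` this gives `energy_le`: the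
energy drops by at least `c * ∫ ‖u‖ ^ 2`.

By compactness the energy is bounded below, so `‖u‖ ^ 2` is integrable on the half-line. Averaging
the energy inequality over unit windows upgrades this to `u → 0`. If a cluster point of `x` were not
stationary, the constraint qualification would give a descent direction `v` that is strictly
feasible to first order. Near that point every reaction pushes along `v`, so `⟪v, u⟫` would grow by
a fixed amount in unit time, against `u → 0` (`mem_stationarySet_of_mapClusterPt`).

A strict local minimum has an energy barrier on a small sphere intersected with `C`, hence is
stable. An isolated local minimum is strict. Stability traps nearby trajectories where no other
stationary point exists, and convergence to the stationary set becomes convergence to the minimum.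

The analytic difficulty is the chain rule for `‖u‖ ^ 2` when `u` has countably many jumps, possibly
accumulating. It is obtained from Fubini for a measure with atoms (`normSq_sub_le`). -/

section General

variable {E : Type*} [NormedAddCommGroup E] [InnerProductSpace ℝ E] [CompleteSpace E]

/-! ### Fubini and integration for measures with atoms -/

/-- Integration by parts for the distribution function `t ↦ ∫ s in Iic t, h s ∂ν` against itself. -/
theorem integral_inner_setIntegral_Iic_add_Iio {ν : Measure ℝ} [SFinite ν] {h : ℝ → E}
    (hh : Integrable h ν) :
    ∫ t, inner ℝ (h t) ((∫ s in Iic t, h s ∂ν) + ∫ s in Iio t, h s ∂ν) ∂ν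
      = ‖∫ t, h t ∂ν‖ ^ 2 := by
  set G : ℝ × ℝ → ℝ := fun p => inner ℝ (h p.1) (h p.2) with hG
  have hGi : Integrable G (ν.prod ν) :=
    hh.op_fst_snd (op := fun x y : E => inner ℝ x y) (continuous_inner (𝕜 := ℝ) (E := E))
      ⟨1, fun x y => by simpa using norm_inner_le_norm (𝕜 := ℝ) x y⟩ hh
  have key : ∀ A : ℝ → Set ℝ, (∀ t, MeasurableSet (A t)) →
      MeasurableSet {p : ℝ × ℝ | p.2 ∈ A p.1} →
      Integrable (fun t => inner ℝ (h t) (∫ s in A t, h s ∂ν)) ν ∧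
      ∫ t, inner ℝ (h t) (∫ s in A t, h s ∂ν) ∂ν
        = ∫ p, {p : ℝ × ℝ | p.2 ∈ A p.1}.indicator G p ∂(ν.prod ν) := by
    intro A hA hA'
    have hi := hGi.indicator hA'
    have heq : ∀ t, ∫ s, {p : ℝ × ℝ | p.2 ∈ A p.1}.indicator G (t, s) ∂ν
        = inner ℝ (h t) (∫ s in A t, h s ∂ν) := by
      intro t
      rw [← integral_inner hh.integrableOn, ← integral_indicator (hA t)]
      rfl
    constructor
    · have := hi.integral_prod_left
      simpa only [heq] using this
    · rw [integral_prod _ hi]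
      simp only [heq]
  obtain ⟨i1, e1⟩ := key Iic (fun _ => measurableSet_Iic)
    (measurableSet_le measurable_snd measurable_fst)
  obtain ⟨i2, e2⟩ := key Iio (fun _ => measurableSet_Iio)
    (measurableSet_lt measurable_snd measurable_fst)
  simp only [inner_add_right]
  rw [integral_add i1 i2, e1, e2, ← integral_prod_swap,
    ← integral_add]
  -- The two half-planes tile the plane; one is closed and the other open, so the diagonal, which
  -- carries mass at atoms, is counted exactly once.
  · have : ∀ p : ℝ × ℝ, {p : ℝ × ℝ | p.2 ∈ Iic p.1}.indicator G p.swap +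
        {p : ℝ × ℝ | p.2 ∈ Iio p.1}.indicator G p = G p := by
      rintro ⟨x, y⟩
      rcases le_or_gt x y with hxy | hxy
      · simp [hG, hxy, not_lt.2 hxy, real_inner_comm]
      · simp [hG, hxy, not_le.2 hxy]
    simp only [this]
    rw [integral_prod _ hGi]
    simp only [hG]
    simp_rw [integral_inner hh]
    have h2 : ∀ x, inner ℝ (h x) (∫ t, h t ∂ν) = inner ℝ (∫ t, h t ∂ν) (h x) :=
      fun x => real_inner_comm _ _
    simp_rw [h2]
    rw [integral_inner hh, real_inner_self_eq_norm_sq]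
  · exact (hGi.indicator (measurableSet_le measurable_snd measurable_fst)).swap
  · exact hGi.indicator (measurableSet_lt measurable_snd measurable_fst)

/-- Integration against the sum of Lebesgue measure on `S` and the Dirac masses at the points of a
countable set `D`. -/
theorem integral_restrict_add_sum_dirac {E : Type*} [NormedAddCommGroup E] [NormedSpace ℝ E]
    [CompleteSpace E] {S D : Set ℝ} (hD : D.Countable) {F b j : ℝ → E}
    (hb : IntegrableOn b S) (hj : Summable fun σ : D => ‖j σ‖) (hFj : ∀ σ ∈ D, F σ = j σ)
    (hFb : ∀ σ ∉ D, F σ = b σ) :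
    Integrable F (volume.restrict S + Measure.sum fun σ : D => (1 : ENNReal) • Measure.dirac (σ : ℝ)) ∧
    ∫ t, F t ∂(volume.restrict S + Measure.sum fun σ : D => (1 : ENNReal) • Measure.dirac (σ : ℝ))
      = (∫ t in S, b t) + ∑' σ : D, j σ := by
  have := hD.to_subtype
  have hae : b =ᵐ[volume.restrict S] F := by
    have : ∀ᵐ t ∂(volume.restrict S), t ∉ D := hD.ae_notMem _
    filter_upwards [this] with t ht using (hFb t ht).symm
  have h1 : Integrable F (volume.restrict S) := hb.congr hae
  have hs : Summable fun σ : D => (1 : ENNReal).toReal * ‖F σ‖ := by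
    refine hj.congr fun σ => ?_
    rw [hFj σ σ.2]; simp
  have h2 := integrable_sum_dirac (X := ℝ) (x := fun σ : D => (σ : ℝ)) (f := F)
    (c := fun _ => (1 : ENNReal)) (fun _ => by simp) hs
  refine ⟨h1.add_measure h2, ?_⟩
  rw [integral_add_measure h1 h2, integral_congr_ae hae,
    integral_sum_dirac_eq_tsum (fun _ => by simp) hs]
  congr 1
  exact tsum_congr fun σ => by simp [hFj σ σ.2]

end General

/-! ### Velocities of bounded variation: limits, jumps, chain rule -/

namespace AccFlow

variable {n m : ℕ}

namespace IsNonsingularBV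

variable {um up a : ℝ → Vec n}

theorem summable_indicator (h : IsNonsingularBV um up a) {S : Set ℝ} {T : ℝ} (hS : S ⊆ Icc 0 T) :
    Summable (S.indicator fun s => ‖up s - um s‖) := by
  rcases le_or_gt 0 T with hT | hT
  · have h1 : Summable ((Icc 0 T).indicator fun s => ‖up s - um s‖) :=
      summable_subtype_iff_indicator.1 (h.summable T hT)
    have := h1.indicator S
    rwa [indicator_indicator, inter_eq_self_of_subset_left hS] at this
  · rw [Icc_eq_empty (not_le.2 hT), subset_empty_iff] at hS
    simp [hS, summable_zero]

theorem summable_indicator_vec (h : IsNonsingularBV um up a) {S : Set ℝ} {T : ℝ}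
    (hS : S ⊆ Icc 0 T) : Summable (S.indicator fun s => up s - um s) := by
  refine Summable.of_norm ((h.summable_indicator hS).congr fun s => ?_)
  rw [norm_indicator_eq_indicator_norm]

theorem right_indicator (h : IsNonsingularBV um up a) {t : ℝ} (ht : 0 ≤ t) :
    up t = um 0 + (∫ s in (0 : ℝ)..t, a s) + ∑' s, (Icc 0 t).indicator (fun s => up s - um s) s := by
  rw [h.right t ht, tsum_subtype (Icc 0 t) (fun s => up s - um s)]

theorem left_indicator (h : IsNonsingularBV um up a) {t : ℝ} (ht : 0 ≤ t) :
    um t = um 0 + (∫ s in (0 : ℝ)..t, a s) + ∑' s, (Ico 0 t).indicator (fun s => up s - um s) s := by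
  rw [h.left t ht, tsum_subtype (Ico 0 t) (fun s => up s - um s)]

theorem intervalIntegrable (h : IsNonsingularBV um up a) {s t : ℝ} (hs : 0 ≤ s) (ht : 0 ≤ t) :
    IntervalIntegrable a volume s t :=
  (h.integrable s hs).symm.trans (h.integrable t ht)

theorem right_sub (h : IsNonsingularBV um up a) {s t : ℝ} (hs : 0 ≤ s) (hst : s ≤ t) :
    up t - up s = (∫ σ in s..t, a σ) + ∑' σ, (Ioc s t).indicator (fun s => up s - um s) σ := by
  rw [h.right_indicator (hs.trans hst), h.right_indicator hs,
    ← intervalIntegral.integral_add_adjacent_intervals (h.integrable s hs)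
      (h.intervalIntegrable hs (hs.trans hst))]
  have hd : Disjoint (Icc 0 s) (Ioc s t) := by
    rw [Set.disjoint_left]; rintro x hx hx'; exact absurd hx.2 (not_le.2 hx'.1)
  have : Icc 0 t = Icc 0 s ∪ Ioc s t := (Icc_union_Ioc_eq_Icc hs hst).symm
  rw [this, indicator_union_of_disjoint hd, Summable.tsum_add
    (h.summable_indicator_vec (T := t) (Icc_subset_Icc_right hst))
    (h.summable_indicator_vec (T := t) (fun x hx => ⟨hs.trans hx.1.le, hx.2⟩))]
  abel

theorem left_sub (h : IsNonsingularBV um up a) {s t : ℝ} (hs : 0 ≤ s) (hst : s < t) :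
    um t - up s = (∫ σ in s..t, a σ) + ∑' σ, (Ioo s t).indicator (fun s => up s - um s) σ := by
  rw [h.left_indicator (hs.trans hst.le), h.right_indicator hs,
    ← intervalIntegral.integral_add_adjacent_intervals (h.integrable s hs)
      (h.intervalIntegrable hs (hs.trans hst.le))]
  have hd : Disjoint (Icc 0 s) (Ioo s t) := by
    rw [Set.disjoint_left]; rintro x hx hx'; exact absurd hx.2 (not_le.2 hx'.1)
  have : Ico 0 t = Icc 0 s ∪ Ioo s t := (Icc_union_Ioo_eq_Ico hs hst).symm
  rw [this, indicator_union_of_disjoint hd, Summable.tsum_add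
    (h.summable_indicator_vec (T := t) (Icc_subset_Icc_right hst.le))
    (h.summable_indicator_vec (T := t) (fun x hx => ⟨hs.trans hx.1.le, hx.2.le⟩))]
  abel

theorem continuousOn_integral (h : IsNonsingularBV um up a) {T : ℝ} (hT : 0 ≤ T) :
    ContinuousOn (fun t => ∫ s in (0 : ℝ)..t, a s) (Icc 0 T) := by
  have := intervalIntegral.continuousOn_primitive_interval' (h.integrable T hT)
    (left_mem_uIcc)
  rwa [uIcc_of_le hT] at this

/-- Dominated convergence for the sum over jumps: each indicator is eventually constant as `t'`
decreases to `t`, and the jumps on `[0, t + 1]` dominate. From the left the jump at `t` itself is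
lost, which is why `tendsto_left` produces `um t`. -/
theorem tendsto_right (h : IsNonsingularBV um up a) {t : ℝ} (ht : 0 ≤ t) :
    Tendsto up (𝓝[>] t) (𝓝 (up t)) := by
  have hev : ∀ᶠ t' in 𝓝[>] t, t < t' ∧ t' ≤ t + 1 := by
    filter_upwards [Ioc_mem_nhdsGT (show t < t + 1 by linarith)] with t' h' using h'
  have h1 : Tendsto (fun t' => ∫ s in (0 : ℝ)..t', a s) (𝓝[>] t) (𝓝 (∫ s in (0 : ℝ)..t, a s)) := by
    have hc := h.continuousOn_integral (T := t + 1) (by linarith) t ⟨ht, by linarith⟩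
    refine hc.mono_left (nhdsWithin_le_iff.2 ?_)
    filter_upwards [hev] with t' h' using ⟨by linarith, h'.2⟩
  have h2 : Tendsto (fun t' => ∑' s, (Icc 0 t').indicator (fun s => up s - um s) s) (𝓝[>] t)
      (𝓝 (∑' s, (Icc 0 t).indicator (fun s => up s - um s) s)) := by
    refine tendsto_tsum_of_dominated_convergence
      (h.summable_indicator (T := t + 1) (S := Icc 0 (t + 1)) subset_rfl) (fun s => ?_) ?_
    · refine tendsto_const_nhds.congr' ?_
      rcases le_or_gt s t with hst | hst
      · filter_upwards [hev] with t' h'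
        simp [indicator, hst, hst.trans h'.1.le]
      · filter_upwards [Ioo_mem_nhdsGT hst] with t' h'
        simp [indicator, not_le.2 hst, not_le.2 h'.2]
    · filter_upwards [hev] with t' h' s
      rw [norm_indicator_eq_indicator_norm]
      exact indicator_le_indicator_of_subset (Icc_subset_Icc_right h'.2) (fun _ => norm_nonneg _) _
  have h3 := (h1.const_add (um 0)).add h2
  rw [← h.right_indicator ht] at h3
  refine h3.congr' ?_
  filter_upwards [hev] with t' h' using (h.right_indicator (ht.trans h'.1.le)).symm

theorem tendsto_left (h : IsNonsingularBV um up a) {t : ℝ} (ht : 0 < t) :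
    Tendsto up (𝓝[<] t) (𝓝 (um t)) := by
  have hev : ∀ᶠ t' in 𝓝[<] t, 0 < t' ∧ t' < t := by
    filter_upwards [Ioo_mem_nhdsLT ht] with t' h' using h'
  have h1 : Tendsto (fun t' => ∫ s in (0 : ℝ)..t', a s) (𝓝[<] t) (𝓝 (∫ s in (0 : ℝ)..t, a s)) := by
    have hc := h.continuousOn_integral ht.le t ⟨ht.le, le_rfl⟩
    refine hc.mono_left (nhdsWithin_le_iff.2 ?_)
    filter_upwards [hev] with t' h' using ⟨h'.1.le, h'.2.le⟩
  have h2 : Tendsto (fun t' => ∑' s, (Icc 0 t').indicator (fun s => up s - um s) s) (𝓝[<] t)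
      (𝓝 (∑' s, (Ico 0 t).indicator (fun s => up s - um s) s)) := by
    refine tendsto_tsum_of_dominated_convergence
      (h.summable_indicator (T := t) (S := Icc 0 t) subset_rfl) (fun s => ?_) ?_
    · refine tendsto_const_nhds.congr' ?_
      rcases lt_or_ge s t with hst | hst
      · filter_upwards [Ioo_mem_nhdsLT hst] with t' h'
        simp [indicator, hst, h'.1.le]
      · filter_upwards [hev] with t' h'
        simp [indicator, not_lt.2 hst, not_le.2 (h'.2.trans_le hst)]
    · filter_upwards [hev] with t' h' s
      rw [norm_indicator_eq_indicator_norm]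
      exact indicator_le_indicator_of_subset (Icc_subset_Icc_right h'.2.le)
        (fun _ => norm_nonneg _) _
  have h3 := (h1.const_add (um 0)).add h2
  rw [← h.left_indicator ht.le] at h3
  refine h3.congr' ?_
  filter_upwards [hev] with t' h' using (h.right_indicator h'.1.le).symm

theorem countable_jumps (h : IsNonsingularBV um up a) :
    {t | 0 ≤ t ∧ up t ≠ um t}.Countable := by
  have : {t | 0 ≤ t ∧ up t ≠ um t}
      = ⋃ N : ℕ, Function.support ((Icc (0 : ℝ) N).indicator fun s => ‖up s - um s‖) := by
    ext t
    simp only [mem_ofPred_eq, mem_iUnion, Function.mem_support, ne_eq, indicator_apply_eq_zero,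
      mem_Icc, norm_eq_zero, sub_eq_zero, Classical.not_imp]
    constructor
    · rintro ⟨h0, h1⟩
      obtain ⟨N, hN⟩ := exists_nat_ge t
      exact ⟨N, ⟨h0, hN⟩, h1⟩
    · rintro ⟨N, ⟨h0, _⟩, h1⟩
      exact ⟨h0, h1⟩
  rw [this]
  exact countable_iUnion fun N => (h.summable_indicator (T := N) subset_rfl).countable_support

theorem ae_eq (h : IsNonsingularBV um up a) :
    ∀ᵐ t ∂(volume.restrict (Ici (0 : ℝ))), up t = um t := by
  filter_upwards [h.countable_jumps.ae_notMem (volume.restrict (Ici (0 : ℝ))),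
    ae_restrict_mem measurableSet_Ici] with t ht h0
  by_contra hne
  exact ht ⟨h0, hne⟩

theorem exists_bound (h : IsNonsingularBV um up a) {T : ℝ} (hT : 0 ≤ T) :
    ∃ M, ∀ t ∈ Icc 0 T, ‖up t‖ ≤ M ∧ ‖um t‖ ≤ M := by
  obtain ⟨K, hK⟩ := isCompact_Icc.exists_bound_of_continuousOn (h.continuousOn_integral hT)
  have hs := h.summable_indicator (T := T) (S := Icc 0 T) subset_rfl
  have key : ∀ S ⊆ Icc (0 : ℝ) T, ‖∑' s, S.indicator (fun s => up s - um s) s‖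
      ≤ ∑' s, (Icc 0 T).indicator (fun s => ‖up s - um s‖) s := by
    intro S hS
    refine tsum_of_norm_bounded hs.hasSum fun s => ?_
    rw [norm_indicator_eq_indicator_norm]
    exact indicator_le_indicator_of_subset hS (fun _ => norm_nonneg _) _
  refine ⟨‖um 0‖ + K + ∑' s, (Icc 0 T).indicator (fun s => ‖up s - um s‖) s, fun t ht => ⟨?_, ?_⟩⟩
  · rw [h.right_indicator ht.1]
    refine (norm_add_le _ _).trans (add_le_add ((norm_add_le _ _).trans ?_)
      (key _ (Icc_subset_Icc_right ht.2)))
    gcongr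
    exact hK t ht
  · rw [h.left_indicator ht.1]
    refine (norm_add_le _ _).trans (add_le_add ((norm_add_le _ _).trans ?_)
      (key _ (fun x hx => ⟨hx.1, hx.2.le.trans ht.2⟩)))
    gcongr
    exact hK t ht

/-- If the norm does not increase at jumps, then its square grows at most by the contribution of the
absolutely continuous part. -/
theorem normSq_sub_le (h : IsNonsingularBV um up a) {s r : ℝ} (hs : 0 ≤ s) (hsr : s ≤ r)
    (hup : IntervalIntegrable up volume s r)
    (hj : ∀ t ∈ Ioc s r, ‖up t‖ ≤ ‖um t‖) :
    ‖up r‖ ^ 2 - ‖up s‖ ^ 2 ≤ 2 * ∫ t in s..r, inner ℝ (a t) (up t) := by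
  classical
  have hr := hs.trans hsr
  set D : Set ℝ := {t | 0 ≤ t ∧ up t ≠ um t} ∩ Ioc s r with hD
  have hDr : D ⊆ Icc 0 r := fun x hx => ⟨hs.trans hx.2.1.le, hx.2.2⟩
  have hDc : D.Countable := h.countable_jumps.mono inter_subset_left
  have := hDc.to_subtype
  set j : ℝ → Vec n := fun t => up t - um t with hjdef
  -- `H` is the density of `du` with respect to Lebesgue measure plus unit masses at the jumps. Its
  -- distribution function relative to `up s` is `up` with closed rays and `um` with open rays
  -- (`hIic`, `hIio`).
  set H : ℝ → Vec n := fun t => if t ∈ D then j t else a t with hH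
  set ν : Measure ℝ := volume.restrict (Ioc s r) +
    Measure.sum fun σ : D => (1 : ENNReal) • Measure.dirac (σ : ℝ) with hν
  obtain ⟨M, hM⟩ := h.exists_bound hr
  have hM' : ∀ t ∈ Ioc s r, ‖up t‖ ≤ M ∧ ‖um t‖ ≤ M := fun t ht => hM t ⟨hs.trans ht.1.le, ht.2⟩
  have ha : IntegrableOn a (Ioc s r) :=
    (intervalIntegrable_iff_integrableOn_Ioc_of_le hsr).1 (h.intervalIntegrable hs hr)
  have hsum : Summable fun σ : D => ‖j σ‖ :=
    summable_subtype_iff_indicator.2 (h.summable_indicator hDr)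
  have hHint := (integral_restrict_add_sum_dirac hDc (F := H) ha hsum
    (fun σ hσ => if_pos hσ) (fun σ hσ => if_neg hσ)).1
  have hcum : ∀ A : Set ℝ, MeasurableSet A → ∫ t in A, H t ∂ν
      = (∫ t in Ioc s r ∩ A, a t) + ∑' σ, (Ioc s r ∩ A).indicator j σ := by
    intro A hA
    rw [← integral_indicator hA]
    rw [(integral_restrict_add_sum_dirac hDc (F := A.indicator H) (b := A.indicator a)
      (j := A.indicator j) (ha.indicator hA) ?_ ?_ ?_).2]
    · rw [setIntegral_indicator hA, tsum_subtype D (A.indicator j), indicator_indicator]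
      congr 2
      ext σ : 1
      by_cases hσ : σ ∈ Ioc s r ∩ A
      · rw [indicator_of_mem hσ]
        by_cases h0 : σ ∈ D
        · rw [indicator_of_mem (show σ ∈ D ∩ A from ⟨h0, hσ.2⟩)]
        · rw [indicator_of_notMem (fun h' => h0 h'.1)]
          by_contra hne
          refine h0 ⟨⟨hs.trans hσ.1.1.le, fun he => hne ?_⟩, hσ.1⟩
          simp [hjdef, he]
      · rw [indicator_of_notMem hσ, indicator_of_notMem (fun h' => hσ ⟨h'.1.2, h'.2⟩)]
    · refine hsum.of_nonneg_of_le (fun _ => norm_nonneg _) fun σ => norm_indicator_le_norm_self _ _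
    · intro σ hσ
      simp [indicator, hH, hσ]
    · intro σ hσ
      simp [indicator, hH, hσ]
  have hIic : ∀ t ∈ Ioc s r, ∫ σ in Iic t, H σ ∂ν = up t - up s := by
    intro t ht
    rw [hcum _ measurableSet_Iic, h.right_sub hs ht.1.le, intervalIntegral.integral_of_le ht.1.le,
      Ioc_inter_Iic, inf_eq_right.2 ht.2]
  have hIio : ∀ t ∈ Ioc s r, ∫ σ in Iio t, H σ ∂ν = um t - up s := by
    intro t ht
    have : Ioc s r ∩ Iio t = Ioo s t := by
      ext x; simp only [mem_inter_iff, mem_Ioc, mem_Iio, mem_Ioo]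
      exact ⟨fun hx => ⟨hx.1.1, hx.2⟩, fun hx => ⟨⟨hx.1, hx.2.le.trans ht.2⟩, hx.2⟩⟩
    rw [hcum _ measurableSet_Iio, h.left_sub hs ht.1, intervalIntegral.integral_of_le ht.1.le,
      this, integral_Ioc_eq_integral_Ioo]
  have htot : ∫ t, H t ∂ν = up r - up s := by
    rw [← setIntegral_univ, hcum _ MeasurableSet.univ, h.right_sub hs hsr,
      intervalIntegral.integral_of_le hsr, inter_univ]
  have hmem : ∀ᵐ t ∂ν, t ∈ Ioc s r := by
    rw [hν, ae_add_measure_iff]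
    refine ⟨ae_restrict_mem measurableSet_Ioc, ?_⟩
    rw [Measure.ae_sum_iff]
    intro σ
    rw [one_smul, ae_dirac_eq]
    exact σ.2.2
  have hpi := integral_inner_setIntegral_Iic_add_Iio hHint
  rw [← hν, htot] at hpi
  have hum : um =ᵐ[volume.restrict (Ioc s r)] up := by
    filter_upwards [ae_restrict_of_ae_restrict_of_subset
      (fun x hx => hs.trans hx.1.le : Ioc s r ⊆ Ici 0) h.ae_eq] with t ht using ht.symm
  have hupm : AEStronglyMeasurable up (volume.restrict (Ioc s r)) :=
    ((intervalIntegrable_iff_integrableOn_Ioc_of_le hsr).1 hup).aestronglyMeasurable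
  have hau : IntegrableOn (fun t => inner ℝ (a t) (up t)) (Ioc s r) := by
    refine Integrable.mono' (ha.norm.mul_const M) (ha.aestronglyMeasurable.inner hupm) ?_
    filter_upwards [ae_restrict_mem measurableSet_Ioc] with t ht
    refine (norm_inner_le_norm _ _).trans ?_
    gcongr
    exact (hM' t ht).1
  -- Off the countable jump set `up + um` is `2 • up`, the source of the factor 2; at a jump,
  -- pairing with `up + um` gives the exact change of the squared norm.
  have hau' : (fun t => 2 * inner ℝ (a t) (up t)) =ᵐ[volume.restrict (Ioc s r)]
      fun t => inner ℝ (a t) (up t + um t) := by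
    filter_upwards [hum] with t ht
    rw [ht, inner_add_right]; ring
  obtain ⟨hint, heq⟩ := integral_restrict_add_sum_dirac hDc
    (F := fun t => inner ℝ (H t) (up t + um t)) (b := fun t => inner ℝ (a t) (up t + um t))
    (j := fun t => inner ℝ (j t) (up t + um t)) (S := Ioc s r)
    ((hau.const_mul 2).congr hau')
    ((hsum.mul_right (2 * M)).of_nonneg_of_le (fun _ => norm_nonneg _) (fun σ => by
      refine (norm_inner_le_norm _ _).trans ?_
      gcongr
      refine (norm_add_le _ _).trans ?_
      linarith [(hM' σ σ.2.2).1, (hM' σ σ.2.2).2]))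
    (fun σ hσ => by simp only [hH, if_pos hσ]) (fun σ hσ => by simp only [hH, if_neg hσ])
  rw [← hν] at hint heq
  have hneg : ∑' σ : D, inner ℝ (j σ) (up σ + um σ) ≤ 0 := by
    refine tsum_nonpos fun σ => ?_
    have := hj σ σ.2.2
    have h2 : inner ℝ (j σ) (up σ + um σ) = ‖up σ‖ ^ 2 - ‖um σ‖ ^ 2 := by
      simp only [hjdef, inner_sub_left, inner_add_right, real_inner_self_eq_norm_sq,
        real_inner_comm (up σ) (um σ)]
      ring
    rw [h2, sub_nonpos]
    gcongr
  have hsplit : ∫ t, inner ℝ (H t) ((∫ σ in Iic t, H σ ∂ν) + ∫ σ in Iio t, H σ ∂ν) ∂ν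
      = ∫ t, inner ℝ (H t) (up t + um t) ∂ν - 2 * inner ℝ (up r - up s) (up s) := by
    have hc : Integrable (fun t => 2 * inner ℝ (H t) (up s)) ν :=
      (hHint.inner_const (up s)).const_mul 2
    have : 2 * inner ℝ (up r - up s) (up s) = ∫ t, 2 * inner ℝ (H t) (up s) ∂ν := by
      rw [integral_const_mul, ← htot, real_inner_comm, ← integral_inner hHint]
      simp only [real_inner_comm, hν]
    rw [this, ← integral_sub hint hc]
    refine integral_congr_ae ?_
    filter_upwards [hmem] with t ht
    rw [hIic t ht, hIio t ht]
    simp only [inner_add_right, inner_sub_right]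
    ring
  rw [hsplit, heq, ← integral_congr_ae hau', integral_const_mul,
    ← intervalIntegral.integral_of_le hsr] at hpi
  have h3 : ‖up r - up s‖ ^ 2 + 2 * inner ℝ (up r - up s) (up s) = ‖up r‖ ^ 2 - ‖up s‖ ^ 2 := by
    rw [← real_inner_self_eq_norm_sq, ← real_inner_self_eq_norm_sq, ← real_inner_self_eq_norm_sq]
    simp only [inner_sub_left, inner_sub_right, real_inner_comm (up r) (up s)]
    ring
  linarith

end IsNonsingularBV

end AccFlow

/-! ### Feasibility and energy dissipation along trajectories -/

namespace AccFlow

variable {n m : ℕ}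

theorem mem_normalCone_Iic_zero {l w : ℝ} :
    w ∈ normalCone (Iic 0) (-l) ↔ 0 ≤ l ∧ 0 ≤ w ∧ l * w = 0 := by
  simp only [normalCone, mem_ofPred_eq, mem_Iic]
  constructor
  -- The test points `-l - 1` and `0` give the sign of `w` and the complementarity.
  · rintro ⟨h1, h2⟩
    have h3 := h2 (-l - 1) (by linarith)
    have h4 := h2 0 le_rfl
    have hw : 0 ≤ w := by linarith
    have := mul_nonneg (show 0 ≤ l by linarith) hw
    exact ⟨by linarith, hw, by linarith⟩
  · rintro ⟨h1, h2, h3⟩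
    exact ⟨by linarith, fun y hy => by nlinarith [mul_nonneg h2 (neg_nonneg.2 hy)]⟩

theorem mem_activeSet {g : Fin m → Vec n → ℝ} {x : Vec n} {i : Fin m} :
    i ∈ activeSet g x ↔ g i x ≤ 0 := by
  simp [activeSet]

theorem eq_zero_of_mem_activeSet {g : Fin m → Vec n → ℝ} {x : Vec n} {i : Fin m}
    (hx : x ∈ feasibleSet g) (hi : i ∈ activeSet g x) : g i x = 0 :=
  le_antisymm (mem_activeSet.1 hi) (hx i)

theorem continuous_gradient_of_contDiff {φ : Vec n → ℝ} (hφ : ContDiff ℝ 1 φ) :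
    Continuous (gradient φ) :=
  (InnerProductSpace.toDual ℝ (Vec n)).symm.continuous.comp (hφ.continuous_fderiv one_ne_zero)

theorem hasDerivWithinAt_comp_gradient {φ : Vec n → ℝ} (hφ : Differentiable ℝ φ) {y : ℝ → Vec n}
    {y' : Vec n} {S : Set ℝ} {t : ℝ} (hy : HasDerivWithinAt y y' S t) :
    HasDerivWithinAt (fun s => φ (y s)) (inner ℝ (gradient φ (y t)) y') S t := by
  have h := (hφ (y t)).hasFDerivAt.comp_hasDerivWithinAt t hy
  rwa [← inner_gradient_left] at h

namespace IsTrajectory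

variable {f : Vec n → ℝ} {g : Fin m → Vec n → ℝ} {α β δ ε : ℝ} {x um up : ℝ → Vec n}

theorem intervalIntegrable (h : IsTrajectory f g α β δ ε x um up) {s t : ℝ} (hs : 0 ≤ s)
    (ht : 0 ≤ t) : IntervalIntegrable up volume s t :=
  (h.1 s hs).1.symm.trans (h.1 t ht).1

theorem sub_eq (h : IsTrajectory f g α β δ ε x um up) {s t : ℝ} (hs : 0 ≤ s) (ht : 0 ≤ t) :
    x t - x s = ∫ σ in s..t, up σ := by
  rw [(h.1 s hs).2, (h.1 t ht).2, ← intervalIntegral.integral_add_adjacent_intervals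
    (h.1 s hs).1 (h.intervalIntegrable hs ht)]
  abel

theorem continuousOn_Icc (h : IsTrajectory f g α β δ ε x um up) {T : ℝ} (hT : 0 ≤ T) :
    ContinuousOn x (Icc 0 T) := by
  have h1 := intervalIntegral.continuousOn_primitive_interval' (h.1 T hT).1 left_mem_uIcc
  rw [uIcc_of_le hT] at h1
  exact (h1.const_add (x 0)).congr fun t ht => (h.1 t ht.1).2

theorem continuousOn_Icc_of_nonneg (h : IsTrajectory f g α β δ ε x um up) {s t : ℝ} (hs : 0 ≤ s)
    (hst : s ≤ t) : ContinuousOn x (Icc s t) :=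
  (h.continuousOn_Icc (hs.trans hst)).mono (Icc_subset_Icc_left hs)

theorem tendsto_right (h : IsTrajectory f g α β δ ε x um up) {t : ℝ} (ht : 0 ≤ t) :
    Tendsto up (𝓝[>] t) (𝓝 (up t)) := by
  obtain ⟨-, a, l, L, hbv, -⟩ := h
  exact hbv.tendsto_right ht

theorem tendsto_left (h : IsTrajectory f g α β δ ε x um up) {t : ℝ} (ht : 0 < t) :
    Tendsto up (𝓝[<] t) (𝓝 (um t)) := by
  obtain ⟨-, a, l, L, hbv, -⟩ := h
  exact hbv.tendsto_left ht

theorem exists_bound (h : IsTrajectory f g α β δ ε x um up) {T : ℝ} (hT : 0 ≤ T) :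
    ∃ M, ∀ t ∈ Icc 0 T, ‖up t‖ ≤ M := by
  obtain ⟨-, a, l, L, hbv, -⟩ := h
  obtain ⟨M, hM⟩ := hbv.exists_bound hT
  exact ⟨M, fun t ht => (hM t ht).1⟩

theorem intervalIntegrable_inner (h : IsTrajectory f g α β δ ε x um up) {s t : ℝ} (hs : 0 ≤ s)
    (hst : s ≤ t) {v : ℝ → Vec n} (hv : IntervalIntegrable v volume s t) :
    IntervalIntegrable (fun σ => inner ℝ (v σ) (up σ)) volume s t := by
  obtain ⟨M, hM⟩ := h.exists_bound (hs.trans hst)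
  have hu := h.intervalIntegrable hs (hs.trans hst)
  rw [intervalIntegrable_iff_integrableOn_Ioc_of_le hst] at hu hv ⊢
  refine Integrable.mono' (hv.norm.mul_const M)
    (hv.aestronglyMeasurable.inner hu.aestronglyMeasurable) ?_
  filter_upwards [ae_restrict_mem measurableSet_Ioc] with σ hσ
  refine (norm_inner_le_norm _ _).trans ?_
  gcongr
  exact hM σ ⟨hs.trans hσ.1.le, hσ.2⟩

theorem intervalIntegrable_normSq (h : IsTrajectory f g α β δ ε x um up) {s t : ℝ} (hs : 0 ≤ s)
    (hst : s ≤ t) : IntervalIntegrable (fun σ => ‖up σ‖ ^ 2) volume s t := by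
  simpa only [real_inner_self_eq_norm_sq] using
    h.intervalIntegrable_inner hs hst (h.intervalIntegrable hs (hs.trans hst))

/-- Right continuity of `up` gives a right derivative at every instant, impacts included. This
suffices for the fundamental theorem of calculus in `comp_sub_comp`. -/
theorem hasDerivWithinAt (h : IsTrajectory f g α β δ ε x um up) {t : ℝ} (ht : 0 ≤ t) :
    HasDerivWithinAt x (up t) (Ioi t) t := by
  have hmeas : StronglyMeasurableAtFilter up (𝓝[>] t) := by
    refine ⟨Ioc t (t + 1), Ioc_mem_nhdsGT (by linarith), ?_⟩
    exact ((intervalIntegrable_iff_integrableOn_Ioc_of_le (by linarith)).1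
      (h.intervalIntegrable ht (by linarith))).aestronglyMeasurable
  have h1 : HasDerivWithinAt (fun s => ∫ σ in (0 : ℝ)..s, up σ) (up t) (Ici t) t :=
    intervalIntegral.integral_hasDerivWithinAt_right (h.1 t ht).1 hmeas (h.tendsto_right ht)
  refine ((h1.mono Ioi_subset_Ici_self).const_add (x 0)).congr (fun s hs => ?_) (h.1 t ht).2
  exact (h.1 s (ht.trans (le_of_lt hs))).2

theorem comp_sub_comp (h : IsTrajectory f g α β δ ε x um up) {φ : Vec n → ℝ}
    (hφ : Differentiable ℝ φ) (hφ' : Continuous (gradient φ)) {s t : ℝ} (hs : 0 ≤ s)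
    (hst : s ≤ t) :
    IntervalIntegrable (fun σ => inner ℝ (gradient φ (x σ)) (up σ)) volume s t ∧
    φ (x t) - φ (x s) = ∫ σ in s..t, inner ℝ (gradient φ (x σ)) (up σ) := by
  have hx := h.continuousOn_Icc_of_nonneg hs hst
  have hi : IntervalIntegrable (fun σ => inner ℝ (gradient φ (x σ)) (up σ)) volume s t := by
    refine h.intervalIntegrable_inner hs hst (ContinuousOn.intervalIntegrable ?_)
    rw [uIcc_of_le hst]
    exact hφ'.comp_continuousOn hx
  refine ⟨hi, (intervalIntegral.integral_eq_sub_of_hasDeriv_right_of_le hst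
    (hφ.continuous.comp_continuousOn hx) (fun σ hσ => ?_) hi).symm⟩
  exact hasDerivWithinAt_comp_gradient hφ (h.hasDerivWithinAt (hs.trans hσ.1.le))

/-- Trajectories that start in the feasible set remain feasible. -/
theorem mem_feasibleSet (h : IsTrajectory f g α β δ ε x um up) (hα : 0 < α) (hε : 0 ≤ ε)
    (hg : ∀ i, ContDiff ℝ 1 (g i)) (h0 : x 0 ∈ feasibleSet g) {t : ℝ} (ht : 0 ≤ t) :
    x t ∈ feasibleSet g := by
  intro i
  by_contra! hneg
  have hcont : ContinuousOn (fun s => g i (x s)) (Icc 0 t) :=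
    (hg i).continuous.comp_continuousOn (h.continuousOn_Icc ht)
  have hcl : IsCompact (Icc 0 t ∩ (fun s => g i (x s)) ⁻¹' Ici 0) :=
    isCompact_Icc.of_isClosed_subset (hcont.preimage_isClosed_of_isClosed isClosed_Icc isClosed_Ici)
      inter_subset_left
  -- `s` is the last instant at which the constraint holds. After it `g_i < 0`, and `γ_i ≥ 0` forces
  -- a nonnegative derivative, so `g_i` cannot have dropped.
  obtain ⟨s, ⟨⟨hs0, hst⟩, hs1⟩, hmax⟩ := hcl.exists_isGreatest ⟨0, ⟨le_rfl, ht⟩, h0 i⟩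
  have hlt : ∀ σ ∈ Ioc s t, g i (x σ) < 0 := by
    intro σ hσ
    by_contra! hge
    exact absurd (hmax ⟨⟨hs0.trans hσ.1.le, hσ.2⟩, hge⟩) (not_le.2 hσ.1)
  have hftc := (h.comp_sub_comp ((hg i).differentiable one_ne_zero)
    (continuous_gradient_of_contDiff (hg i)) hs0 hst).2
  obtain ⟨-, a, l, L, hbv, -, -, -, hcomp, -⟩ := h
  have hnn : 0 ≤ ∫ σ in s..t, inner ℝ (gradient (g i) (x σ)) (up σ) := by
    refine intervalIntegral.integral_nonneg_of_ae_restrict hst ?_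
    rw [← restrict_Ioc_eq_restrict_Icc]
    have hsub : Ioc s t ⊆ Ici 0 := fun σ hσ => hs0.trans hσ.1.le
    filter_upwards [ae_restrict_of_ae_restrict_of_subset hsub hcomp,
      ae_restrict_of_ae_restrict_of_subset hsub hbv.ae_eq,
      ae_restrict_mem measurableSet_Ioc] with σ h1 h2 h3
    have hgs := hlt σ h3
    have h4 := (mem_normalCone_Iic_zero.1 (h1 i (mem_activeSet.2 hgs.le))).2.1
    rw [← h2] at h4
    have h5 : 0 ≤ gam α (g i) (x σ) (up σ) := by
      by_contra! hlt'
      nlinarith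
    simp only [gam] at h5
    have : α * g i (x σ) ≤ 0 := mul_nonpos_of_nonneg_of_nonpos hα.le hgs.le
    simp only [Pi.zero_apply]
    linarith
  simp only [mem_preimage, mem_Ici] at hs1
  linarith

/-- `g_i ∘ x` vanishes at `t` and is nonnegative afterwards, so its right derivative is nonnegative.
The impact law alone controls only a combination of `up` and `um`. -/
theorem inner_gradient_nonneg (h : IsTrajectory f g α β δ ε x um up)
    (hg : ∀ i, ContDiff ℝ 1 (g i)) (hC : ∀ t, 0 ≤ t → x t ∈ feasibleSet g) {t : ℝ} (ht : 0 ≤ t)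
    {i : Fin m} (hi : i ∈ activeSet g (x t)) : 0 ≤ inner ℝ (gradient (g i) (x t)) (up t) := by
  have hd := hasDerivWithinAt_comp_gradient ((hg i).differentiable one_ne_zero)
    (h.hasDerivWithinAt ht)
  rw [hasDerivWithinAt_iff_tendsto_slope' self_notMem_Ioi] at hd
  refine ge_of_tendsto hd ?_
  filter_upwards [self_mem_nhdsWithin] with s hs
  rw [slope_def_field, eq_zero_of_mem_activeSet (hC t ht) hi, sub_zero]
  exact div_nonneg (hC s (ht.trans (le_of_lt hs)) i) (sub_nonneg.2 (le_of_lt hs))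

/-- The kinetic energy does not increase at impacts. -/
theorem norm_up_le_norm_um (h : IsTrajectory f g α β δ ε x um up) (hε : 0 ≤ ε) (hε1 : ε < 1)
    (hg : ∀ i, ContDiff ℝ 1 (g i)) (hC : ∀ t, 0 ≤ t → x t ∈ feasibleSet g) {t : ℝ} (ht : 0 ≤ t) :
    ‖up t‖ ≤ ‖um t‖ := by
  have hnn := fun i hi => h.inner_gradient_nonneg hg hC ht (i := i) hi
  obtain ⟨-, a, l, L, hbv, -, -, -, -, hjump, himp⟩ := h
  have hj := hjump t ht
  have hc : ∀ i ∈ activeSet g (x t), 0 ≤ L i t ∧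
      L i t * (inner ℝ (gradient (g i) (x t)) (up t)
        + ε * inner ℝ (gradient (g i) (x t)) (um t)) = 0 := by
    intro i hi
    have := mem_normalCone_Iic_zero.1 (himp t ht i hi)
    simp only [gam, eq_zero_of_mem_activeSet (hC t ht) hi, mul_zero, add_zero] at this
    exact ⟨this.1, this.2.2⟩
  -- For `ε = 0` complementarity says nothing about `um`, but the jump is orthogonal to `up` and
  -- Cauchy-Schwarz applies. For `ε > 0` a nonzero impulse forces a nonpositive normal component of
  -- `um`, whose reversal is scaled by `ε < 1`.
  rcases hε.eq_or_lt with rfl | hpos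
  · have h1 : inner ℝ (up t - um t) (up t) = 0 := by
      rw [hj, sum_inner]
      refine Finset.sum_eq_zero fun i hi => ?_
      simpa [real_inner_smul_left] using (hc i hi).2
    rw [inner_sub_left, real_inner_self_eq_norm_sq] at h1
    have h2 := real_inner_le_norm (um t) (up t)
    rcases (norm_nonneg (up t)).eq_or_lt with h3 | h3
    · rw [← h3]; exact norm_nonneg _
    · nlinarith
  · have h1 : inner ℝ (up t - um t) (up t + um t) ≤ 0 := by
      rw [hj, sum_inner]
      refine Finset.sum_nonpos fun i hi => ?_
      obtain ⟨h2, h3⟩ := hc i hi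
      have h4 := hnn i hi
      rw [real_inner_smul_left, inner_add_right]
      rcases mul_eq_zero.1 h3 with h5 | h5
      · simp [h5]
      · refine mul_nonpos_of_nonneg_of_nonpos h2 ?_
        have h6 : inner ℝ (gradient (g i) (x t)) (um t) ≤ 0 := by
          by_contra! h7
          have := mul_pos hpos h7
          linarith
        nlinarith
    have h2 : inner ℝ (up t - um t) (up t + um t) = ‖up t‖ ^ 2 - ‖um t‖ ^ 2 := by
      simp only [inner_sub_left, inner_add_right, real_inner_self_eq_norm_sq,
        real_inner_comm (up t) (um t)]
      ring
    exact (sq_le_sq₀ (norm_nonneg _) (norm_nonneg _)).1 (by linarith)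

/-- The energy inequality between two instants. -/
theorem energy_le (h : IsTrajectory f g α β δ ε x um up) (hε : 0 ≤ ε) (hε1 : ε < 1)
    (hf : OneSmooth f) (hg : ∀ i, ContDiff ℝ 1 (g i)) (hC : ∀ t, 0 ≤ t → x t ∈ feasibleSet g)
    {c : ℝ} (hc : ∀ y u : Vec n,
      c * ‖u‖ ^ 2 ≤ 2 * δ * ‖u‖ ^ 2 + inner ℝ (gradient f (y + β • u) - gradient f y) u)
    {s t : ℝ} (hs : 0 ≤ s) (hst : s ≤ t) :
    ‖up t‖ ^ 2 / 2 + f (x t) + c * ∫ σ in s..t, ‖up σ‖ ^ 2 ≤ ‖up s‖ ^ 2 / 2 + f (x s) := by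
  have hjump := fun t ht => h.norm_up_le_norm_um hε hε1 hg hC (t := t) ht
  obtain ⟨hfi, hftc⟩ := h.comp_sub_comp hf.1 hf.2.continuous hs hst
  have hui := h.intervalIntegrable hs (hs.trans hst)
  have hu2 := h.intervalIntegrable_normSq hs hst
  have hinn := fun v hv => h.intervalIntegrable_inner (v := v) hs hst hv
  obtain ⟨-, a, l, L, hbv, -, -, hode, hcomp, -⟩ := h
  have hai := hinn a (hbv.intervalIntegrable hs (hs.trans hst))
  have hkin := hbv.normSq_sub_le hs hst hui
    (fun σ hσ => hjump σ (hs.trans hσ.1.le))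
  have hmono : (∫ σ in s..t, inner ℝ (a σ) (up σ)) + ∫ σ in s..t, inner ℝ (gradient f (x σ)) (up σ)
      ≤ ∫ σ in s..t, -c * ‖up σ‖ ^ 2 := by
    rw [← intervalIntegral.integral_add hai hfi]
    refine intervalIntegral.integral_mono_ae_restrict hst (hai.add hfi) (hu2.const_mul _) ?_
    rw [← restrict_Ioc_eq_restrict_Icc]
    have hsub : Ioc s t ⊆ Ici 0 := fun σ hσ => hs.trans hσ.1.le
    filter_upwards [ae_restrict_of_ae_restrict_of_subset hsub hcomp,
      ae_restrict_of_ae_restrict_of_subset hsub hode,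
      ae_restrict_of_ae_restrict_of_subset hsub hbv.ae_eq,
      ae_restrict_mem measurableSet_Ioc] with σ h1 h2 h3 h4
    have hσ := hs.trans h4.1.le
    -- The reactions do no work: almost everywhere `um = up`, so complementarity holds with the
    -- harmless factor `1 + ε`.
    have h5 : inner ℝ (∑ i ∈ activeSet g (x σ), l i σ • gradient (g i) (x σ)) (up σ) = 0 := by
      rw [sum_inner]
      refine Finset.sum_eq_zero fun i hi => ?_
      have := (mem_normalCone_Iic_zero.1 (h1 i hi)).2.2
      rw [← h3] at this
      simp only [gam, eq_zero_of_mem_activeSet (hC σ hσ) hi, mul_zero, add_zero] at this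
      rw [real_inner_smul_left]
      have h6 : (1 + ε) * (l i σ * inner ℝ (gradient (g i) (x σ)) (up σ)) = 0 := by linarith
      exact (mul_eq_zero.1 h6).resolve_left (by linarith)
    rw [← h2, inner_add_left, inner_add_left, real_inner_smul_left,
      real_inner_self_eq_norm_sq] at h5
    have h6 := hc (x σ) (up σ)
    rw [inner_sub_left] at h6
    simp only [neg_mul]
    linarith
  rw [intervalIntegral.integral_const_mul] at hmono
  linarith

theorem norm_um_le (h : IsTrajectory f g α β δ ε x um up) {s t M : ℝ} (hs : 0 ≤ s) (hst : s < t)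
    (hM : ∀ σ ∈ Ioo s t, ‖up σ‖ ≤ M) : ‖um t‖ ≤ M := by
  refine le_of_tendsto (h.tendsto_left (hs.trans_lt hst)).norm ?_
  filter_upwards [Ioo_mem_nhdsLT hst] with σ hσ using hM σ hσ

end IsTrajectory

/-- The damping constant of the energy inequality. -/
theorem exists_damping {f : Vec n → ℝ} {β δ : ℝ} (hβ : 0 ≤ β) (hδ : 0 < δ) (hf : OneSmooth f)
    (hfδ : ConvexOn ℝ univ f ∨ 0 < 2 * δ - β) :
    ∃ c > 0, ∀ y u : Vec n,
      c * ‖u‖ ^ 2 ≤ 2 * δ * ‖u‖ ^ 2 + inner ℝ (gradient f (y + β • u) - gradient f y) u := by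
  rcases hfδ with hconv | hpos
  · refine ⟨2 * δ, by linarith, fun y u => ?_⟩
    have hd : ∀ s : ℝ, HasDerivAt (fun s : ℝ => f (y + s • u))
        (inner ℝ (gradient f (y + s • u)) u) s := by
      intro s
      have h1 : HasDerivAt (fun s : ℝ => y + s • u) u s := by
        simpa using ((hasDerivAt_id s).smul_const u).const_add y
      simpa using hasDerivWithinAt_comp_gradient hf.1 h1.hasDerivWithinAt (S := univ)
    have hcv : ConvexOn ℝ univ (fun s : ℝ => f (y + s • u)) := by
      have := hconv.comp_affineMap (AffineMap.lineMap (k := ℝ) y (y + u))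
      simp only [preimage_univ] at this
      refine this.congr fun s _ => ?_
      simp [AffineMap.lineMap_apply, add_comm]
    have := hcv.monotoneOn_deriv (fun s _ => (hd s).differentiableAt) (mem_univ 0) (mem_univ β) hβ
    rw [(hd 0).deriv, (hd β).deriv, zero_smul, add_zero] at this
    rw [inner_sub_left]
    linarith
  · refine ⟨2 * δ - β, hpos, fun y u => ?_⟩
    have h1 := abs_real_inner_le_norm (gradient f (y + β • u) - gradient f y) u
    have h2 : ‖gradient f (y + β • u) - gradient f y‖ ≤ β * ‖u‖ := by
      have := hf.2.dist_le_mul (y + β • u) y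
      simpa [dist_eq_norm, norm_smul, abs_of_nonneg hβ] using this
    have h3 : ‖gradient f (y + β • u) - gradient f y‖ * ‖u‖ ≤ β * ‖u‖ * ‖u‖ := by gcongr
    have := (abs_le.1 (h1.trans h3)).1
    linarith

end AccFlow

/-! ### Stationary points: theorem of alternatives and equilibria -/

namespace AccFlow

variable {n m : ℕ} {f : Vec n → ℝ} {g : Fin m → Vec n → ℝ} {α β δ ε : ℝ}
  {x um up : ℝ → Vec n} {p : Vec n}

/-- A feasible point is stationary, or it admits a strictly feasible direction of descent. -/
theorem mem_stationarySet_or_exists_descent (hMF : MFCQ g) (hp : p ∈ feasibleSet g) :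
    p ∈ stationarySet f g ∨ ∃ v : Vec n, inner ℝ (gradient f p) v < 0 ∧
      ∀ i ∈ activeSet g p, 0 < inner ℝ (gradient (g i) p) v := by
  classical
  set q : Option (activeSet g p) → Vec n :=
    fun o => o.elim (-gradient f p) fun i => gradient (g i) p with hq
  set Φ : (Option (activeSet g p) → ℝ) →L[ℝ] Vec n :=
    ∑ o, (ContinuousLinearMap.proj (R := ℝ) (φ := fun _ : Option (activeSet g p) => ℝ) o).smulRight
      (q o) with hΦ
  have hΦa : ∀ w, Φ w = ∑ o, w o • q o := fun w => by simp [hΦ]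
  -- The image is the convex hull of `-∇f` and the active gradients. If it contains `0`, the weights
  -- are Fritz John multipliers; if not, strict separation from `0` gives the direction.
  by_cases h0 : (0 : Vec n) ∈ Φ '' stdSimplex ℝ (Option (activeSet g p))
  · left
    obtain ⟨w, ⟨hw0, hw1⟩, hw⟩ := h0
    rw [hΦa, Fintype.sum_option] at hw
    rw [Fintype.sum_option] at hw1
    simp only [hq, Option.elim_none, Option.elim_some, smul_neg] at hw
    -- With zero weight on `-∇f`, pairing with the direction from the constraint qualification would
    -- make all weights vanish, though they sum to one.
    have hpos : 0 < w none := by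
      refine (hw0 none).lt_of_ne fun hz => ?_
      obtain ⟨v, hv⟩ := hMF p hp
      rw [← hz, zero_smul, neg_zero, zero_add] at hw
      have h1 : ∑ i : activeSet g p, w (some i) * inner ℝ (gradient (g i) p) v = 0 := by
        have := congrArg (fun y => inner ℝ y v) hw
        simpa [sum_inner, real_inner_smul_left] using this
      have hnn : ∀ i ∈ (Finset.univ : Finset (activeSet g p)),
          0 ≤ w (some i) * inner ℝ (gradient (g i) p) v :=
        fun i _ => mul_nonneg (hw0 _) (hv i i.2).le
      rw [Finset.sum_eq_zero_iff_of_nonneg hnn] at h1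
      have h2 : ∀ i : activeSet g p, w (some i) = 0 := fun i =>
        (mul_eq_zero.1 (h1 i (Finset.mem_univ i))).resolve_right (hv i i.2).ne'
      simp [← hz, h2] at hw1
    refine ⟨hp, fun i => if hi : i ∈ activeSet g p then (w none)⁻¹ * w (some ⟨i, hi⟩) else 0,
      fun i => ?_, fun i => ?_, ?_⟩
    · dsimp only
      split_ifs with hi
      · exact mul_nonneg (inv_nonneg.2 hpos.le) (hw0 _)
      · exact le_rfl
    · dsimp only
      split_ifs with hi
      · rw [eq_zero_of_mem_activeSet hp hi, mul_zero]
      · exact zero_mul _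
    · have h1 : gradient f p = (w none)⁻¹ • ∑ i : activeSet g p, w (some i) • gradient (g i) p := by
        rw [eq_inv_smul_iff₀ hpos.ne']
        exact (neg_add_eq_zero.1 hw)
      have h2 : ∑ i, (if hi : i ∈ activeSet g p then (w none)⁻¹ * w (some ⟨i, hi⟩) else 0) •
          gradient (g i) p = ∑ i ∈ activeSet g p,
          (if hi : i ∈ activeSet g p then (w none)⁻¹ * w (some ⟨i, hi⟩) else 0) •
          gradient (g i) p := by
        symm
        refine Finset.sum_subset (Finset.subset_univ _) fun i _ hi => ?_
        rw [dif_neg hi, zero_smul]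
      rw [h2, ← Finset.sum_coe_sort, h1, Finset.smul_sum]
      refine Finset.sum_congr rfl fun i _ => ?_
      rw [dif_pos i.2, smul_smul]
  · right
    have hcomp : IsCompact (Φ '' stdSimplex ℝ (Option (activeSet g p))) :=
      (isCompact_stdSimplex ℝ _).image Φ.continuous
    have hconv : Convex ℝ (Φ '' stdSimplex ℝ (Option (activeSet g p))) :=
      (convex_stdSimplex ℝ _).linear_image Φ.toLinearMap
    obtain ⟨F, s, hs, hF⟩ := geometric_hahn_banach_point_closed hconv hcomp.isClosed h0
    rw [map_zero] at hs
    have hFq : ∀ o, 0 < F (q o) := by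
      intro o
      refine hs.trans (hF _ ⟨Pi.single o 1, single_mem_stdSimplex ℝ o, ?_⟩)
      rw [hΦa, Finset.sum_eq_single o (fun o' _ h => by simp [Pi.single_eq_of_ne h]) (by simp)]
      simp
    have hFi : ∀ y, F y = inner ℝ y ((InnerProductSpace.toDual ℝ (Vec n)).symm F) := by
      intro y
      rw [real_inner_comm, InnerProductSpace.toDual_symm_apply]
    refine ⟨(InnerProductSpace.toDual ℝ (Vec n)).symm F, ?_, fun i hi => ?_⟩
    · have := hFq none
      simp only [hq, Option.elim_none, map_neg] at this
      rw [← hFi]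
      linarith
    · rw [← hFi]
      exact hFq (some ⟨i, hi⟩)

theorem eventually_lt_of_hasDerivAt_pos {φ : ℝ → ℝ} {d t : ℝ} (h : HasDerivAt φ d t) (hd : 0 < d) :
    ∀ᶠ s in 𝓝[>] t, φ t < φ s := by
  have h1 := h.hasDerivWithinAt (s := Ioi t)
  rw [hasDerivWithinAt_iff_tendsto_slope' self_notMem_Ioi] at h1
  filter_upwards [h1.eventually_const_lt hd, self_mem_nhdsWithin] with s hs hs'
  exact (slope_pos_iff_of_le (le_of_lt hs')).1 hs

/-- Karush-Kuhn-Tucker: local minima are stationary. -/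
theorem mem_stationarySet_of_isLocalMinOn (hf : Differentiable ℝ f)
    (hg : ∀ i, ContDiff ℝ 1 (g i)) (hMF : MFCQ g) (hp : p ∈ feasibleSet g)
    (hmin : IsLocalMinOn f (feasibleSet g) p) : p ∈ stationarySet f g := by
  refine (mem_stationarySet_or_exists_descent hMF hp).resolve_right ?_
  rintro ⟨v, hfv, hgv⟩
  have hline : ∀ s : ℝ, HasDerivAt (fun s : ℝ => p + s • v) v s := fun s => by
    simpa using ((hasDerivAt_id s).smul_const v).const_add p
  have hderiv : ∀ φ : Vec n → ℝ, Differentiable ℝ φ →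
      HasDerivAt (fun s : ℝ => φ (p + s • v)) (inner ℝ (gradient φ p) v) 0 := by
    intro φ hφ
    simpa using hasDerivWithinAt_comp_gradient hφ (hline 0).hasDerivWithinAt (S := univ)
  have htend : Tendsto (fun s : ℝ => p + s • v) (𝓝[>] 0) (𝓝 p) := by
    have := (hline 0).continuousAt.tendsto
    simp only [zero_smul, add_zero] at this
    exact this.mono_left nhdsWithin_le_nhds
  have hfeas : ∀ᶠ s : ℝ in 𝓝[>] 0, p + s • v ∈ feasibleSet g := by
    refine eventually_all.2 fun i => ?_
    by_cases hi : i ∈ activeSet g p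
    · have h1 := eventually_lt_of_hasDerivAt_pos
        (hderiv (g i) ((hg i).differentiable one_ne_zero)) (hgv i hi)
      filter_upwards [h1] with s hs
      simp only [zero_smul, add_zero] at hs
      exact (hp i).trans hs.le
    · rw [mem_activeSet, not_le] at hi
      have := ((hg i).continuous.tendsto p).comp htend
      filter_upwards [this.eventually_const_lt hi] with s hs using le_of_lt hs
  have hdec := eventually_lt_of_hasDerivAt_pos (hderiv f hf).neg (neg_pos.2 hfv)
  have hmin' := (tendsto_nhdsWithin_iff.2 ⟨htend, hfeas⟩).eventually hmin
  obtain ⟨s, h1, h2⟩ := (hdec.and hmin').exists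
  simp only [zero_smul, add_zero, Pi.neg_apply] at h1
  linarith

theorem isEquilibrium_of_mem_stationarySet (hp : p ∈ stationarySet f g) :
    IsEquilibrium f g α β δ ε p := by
  obtain ⟨hpC, l, hl, hlg, hkkt⟩ := hp
  have hgam : ∀ i ∈ activeSet g p, gam α (g i) p 0 + ε * gam α (g i) p 0 = 0 := by
    intro i hi
    simp [gam, eq_zero_of_mem_activeSet hpC hi]
  -- The Karush-Kuhn-Tucker multipliers serve as constant contact forces, with no impulses.
  refine ⟨fun t _ => ⟨intervalIntegrable_const, by simp⟩, fun _ => 0, fun i _ => l i,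
    fun _ _ => 0, ⟨fun t _ => intervalIntegrable_const, fun t _ => ?_, fun t _ => by simp,
      fun t _ => by simp⟩, fun i t _ => intervalIntegrable_const, fun i t _ => ?_, ?_, ?_,
    fun t _ => by simp, fun t _ i hi => ?_⟩
  · simp
  · simp
  · refine ae_of_all _ fun t => ?_
    simp only [smul_zero, add_zero, zero_add]
    rw [hkkt]
    symm
    refine Finset.sum_subset (Finset.subset_univ _) fun i _ hi => ?_
    rw [mem_activeSet, not_le] at hi
    rw [(mul_eq_zero.1 (hlg i)).resolve_right hi.ne', zero_smul]
  · refine ae_of_all _ fun t i hi => ?_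
    rw [hgam i hi]
    exact mem_normalCone_Iic_zero.2 ⟨hl i, le_rfl, mul_zero _⟩
  · rw [hgam i hi]
    exact mem_normalCone_Iic_zero.2 ⟨le_rfl, le_rfl, mul_zero _⟩

/-- Jumps along `v` only help, so a lower bound on the acceleration integrates to one on the
velocity; applied below to a descent direction. -/
theorem IsNonsingularBV.mul_le_inner_sub {a : ℝ → Vec n} (h : IsNonsingularBV um up a) {s r κ : ℝ}
    {v : Vec n} (hs : 0 ≤ s) (hsr : s ≤ r)
    (ha : ∀ᵐ t ∂(volume.restrict (Ioc s r)), κ ≤ inner ℝ v (a t))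
    (hj : ∀ t ∈ Ioc s r, 0 ≤ inner ℝ v (up t - um t)) :
    (r - s) * κ ≤ inner ℝ v (up r - up s) := by
  have hai := h.intervalIntegrable hs (hs.trans hsr)
  have hsum : Summable ((Ioc s r).indicator fun t => up t - um t) :=
    h.summable_indicator_vec (T := r) (fun t ht => ⟨hs.trans ht.1.le, ht.2⟩)
  rw [h.right_sub hs hsr, inner_add_right]
  have h1 : (r - s) * κ ≤ inner ℝ v (∫ t in s..r, a t) := by
    have he : inner ℝ v (∫ t in s..r, a t) = ∫ t in s..r, inner ℝ v (a t) :=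
      ((innerSL ℝ v).intervalIntegral_comp_comm hai).symm
    have hi : IntervalIntegrable (fun t => inner ℝ v (a t)) volume s r :=
      ⟨(innerSL ℝ v).integrable_comp hai.1, (innerSL ℝ v).integrable_comp hai.2⟩
    rw [he, ← smul_eq_mul, ← intervalIntegral.integral_const]
    refine intervalIntegral.integral_mono_ae_restrict hsr intervalIntegrable_const hi ?_
    rwa [← restrict_Ioc_eq_restrict_Icc]
  have h2 : 0 ≤ inner ℝ v (∑' t, (Ioc s r).indicator (fun t => up t - um t) t) := by
    have he : inner ℝ v (∑' t, (Ioc s r).indicator (fun t => up t - um t) t)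
        = ∑' t, inner ℝ v ((Ioc s r).indicator (fun t => up t - um t) t) :=
      (innerSL ℝ v).map_tsum hsum
    rw [he]
    refine tsum_nonneg fun t => ?_
    by_cases ht : t ∈ Ioc s r
    · rw [indicator_of_mem ht]; exact hj t ht
    · rw [indicator_of_notMem ht, inner_zero_right]
  linarith

/-! ### Decay of the velocity and convergence to stationary points -/

namespace IsTrajectory

theorem energy_le_initial (h : IsTrajectory f g α β δ ε x um up) (hε : 0 ≤ ε) (hε1 : ε < 1)
    (hf : OneSmooth f) (hg : ∀ i, ContDiff ℝ 1 (g i)) (hC : ∀ t, 0 ≤ t → x t ∈ feasibleSet g)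
    {c : ℝ} (hc : ∀ y u : Vec n,
      c * ‖u‖ ^ 2 ≤ 2 * δ * ‖u‖ ^ 2 + inner ℝ (gradient f (y + β • u) - gradient f y) u)
    {t : ℝ} (ht : 0 ≤ t) :
    ‖up t‖ ^ 2 / 2 + f (x t) + c * ∫ σ in (0 : ℝ)..t, ‖up σ‖ ^ 2 ≤ ‖um 0‖ ^ 2 / 2 + f (x 0) := by
  have h1 := h.energy_le hε hε1 hf hg hC hc le_rfl ht
  have h2 : ‖up 0‖ ^ 2 ≤ ‖um 0‖ ^ 2 := by
    gcongr
    exact h.norm_up_le_norm_um hε hε1 hg hC le_rfl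
  linarith

/-- The kinetic energy is bounded by its average over the preceding unit of time, up to the decrease
of the potential. -/
theorem normSq_le_of_energy (h : IsTrajectory f g α β δ ε x um up) (hε : 0 ≤ ε) (hε1 : ε < 1)
    (hf : OneSmooth f) (hg : ∀ i, ContDiff ℝ 1 (g i)) (hC : ∀ t, 0 ≤ t → x t ∈ feasibleSet g)
    {c : ℝ} (hc0 : 0 < c) (hc : ∀ y u : Vec n,
      c * ‖u‖ ^ 2 ≤ 2 * δ * ‖u‖ ^ 2 + inner ℝ (gradient f (y + β • u) - gradient f y) u)
    {M η t : ℝ} (hM : ∀ y ∈ feasibleSet g, ‖gradient f y‖ ≤ M) (hη : 0 < η) (ht : 1 ≤ t) :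
    ‖up t‖ ^ 2 ≤ 2 * η + (1 + M ^ 2 / (2 * η)) * ∫ σ in (t - 1)..t, ‖up σ‖ ^ 2 := by
  have ht0 : 0 ≤ t - 1 := by linarith
  have hu2 := h.intervalIntegrable_normSq ht0 (show t - 1 ≤ t by linarith)
  set q := ∫ σ in (t - 1)..t, ‖up σ‖ ^ 2 with hq
  have key : ∀ s ∈ Icc (t - 1) t,
      ‖up t‖ ^ 2 - 2 * (η + M ^ 2 / (4 * η) * q) ≤ ‖up s‖ ^ 2 := by
    intro s hs
    have hs0 : 0 ≤ s := ht0.trans hs.1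
    have h1 := h.energy_le hε hε1 hf hg hC hc hs0 hs.2
    have h2 : 0 ≤ ∫ σ in s..t, ‖up σ‖ ^ 2 :=
      intervalIntegral.integral_nonneg hs.2 fun σ _ => by positivity
    have h3 : ∫ σ in s..t, ‖up σ‖ ^ 2 ≤ q := by
      rw [hq, ← intervalIntegral.integral_add_adjacent_intervals
        (h.intervalIntegrable_normSq ht0 hs.1) (h.intervalIntegrable_normSq hs0 hs.2)]
      have : 0 ≤ ∫ σ in (t - 1)..s, ‖up σ‖ ^ 2 :=
        intervalIntegral.integral_nonneg hs.1 fun σ _ => by positivity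
      linarith
    obtain ⟨hfi, hftc⟩ := h.comp_sub_comp hf.1 hf.2.continuous hs0 hs.2
    have hi := h.intervalIntegrable_normSq hs0 hs.2
    have h4 : ∫ σ in s..t, (-η + -(M ^ 2 / (4 * η)) * ‖up σ‖ ^ 2)
        ≤ ∫ σ in s..t, inner ℝ (gradient f (x σ)) (up σ) := by
      refine intervalIntegral.integral_mono_on hs.2
        (intervalIntegrable_const.add (hi.const_mul _)) hfi fun σ hσ => ?_
      have h5 := (abs_le.1 (abs_real_inner_le_norm (gradient f (x σ)) (up σ))).1
      have h6 : ‖gradient f (x σ)‖ * ‖up σ‖ ≤ M * ‖up σ‖ := by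
        gcongr
        exact hM _ (hC σ (hs0.trans hσ.1))
      -- Young's inequality bounds the change of potential by a small constant plus a multiple of
      -- the dissipation.
      have h7 : M * ‖up σ‖ ≤ η + M ^ 2 / (4 * η) * ‖up σ‖ ^ 2 := by
        have : η + M ^ 2 / (4 * η) * ‖up σ‖ ^ 2 - M * ‖up σ‖
            = (2 * η - M * ‖up σ‖) ^ 2 / (4 * η) := by
          field_simp; ring
        have h8 : 0 ≤ (2 * η - M * ‖up σ‖) ^ 2 / (4 * η) := by positivity
        linarith
      linarith
    rw [intervalIntegral.integral_add intervalIntegrable_const (hi.const_mul _),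
      intervalIntegral.integral_const_mul, intervalIntegral.integral_const, smul_eq_mul] at h4
    have h9 : (t - s) * η ≤ 1 * η := by
      gcongr
      linarith [hs.1]
    have h10 : M ^ 2 / (4 * η) * ∫ σ in s..t, ‖up σ‖ ^ 2 ≤ M ^ 2 / (4 * η) * q := by
      gcongr
    have h11 := mul_nonneg hc0.le h2
    linarith
  -- Averaging over `s` replaces the unknown `‖up s‖ ^ 2` by its integral over the window.
  have hint := intervalIntegral.integral_mono_on (show t - 1 ≤ t by linarith)
    intervalIntegrable_const hu2 key
  rw [intervalIntegral.integral_const, smul_eq_mul, ← hq] at hint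
  have : M ^ 2 / (2 * η) = 2 * (M ^ 2 / (4 * η)) := by field_simp; ring
  rw [this]
  linarith

theorem tendsto_um_zero (h : IsTrajectory f g α β δ ε x um up)
    (hup : Tendsto up atTop (𝓝 0)) : Tendsto um atTop (𝓝 0) := by
  rw [Metric.tendsto_atTop] at hup ⊢
  intro e he
  obtain ⟨T, hT⟩ := hup (e / 2) (by linarith)
  refine ⟨max T 0 + 1, fun t ht => ?_⟩
  rw [dist_zero_right]
  have := h.norm_um_le (s := max T 0) (t := t) (M := e / 2) (le_max_right _ _) (by linarith)
    fun σ hσ => by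
      have := hT σ ((le_max_left _ _).trans hσ.1.le)
      rw [dist_zero_right] at this
      exact this.le
  linarith

/-- Integrability of `‖up‖ ^ 2` makes the unit-window integrals tend to zero; `normSq_le_of_energy`
turns this into pointwise decay, with `η = e ^ 2 / 4`. -/
theorem tendsto_up_zero (h : IsTrajectory f g α β δ ε x um up) (hε : 0 ≤ ε) (hε1 : ε < 1)
    (hf : OneSmooth f) (hg : ∀ i, ContDiff ℝ 1 (g i)) (hCc : IsCompact (feasibleSet g))
    (hC : ∀ t, 0 ≤ t → x t ∈ feasibleSet g)
    {c : ℝ} (hc0 : 0 < c) (hc : ∀ y u : Vec n,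
      c * ‖u‖ ^ 2 ≤ 2 * δ * ‖u‖ ^ 2 + inner ℝ (gradient f (y + β • u) - gradient f y) u) :
    Tendsto up atTop (𝓝 0) := by
  obtain ⟨M, hM⟩ := hCc.exists_bound_of_continuousOn hf.2.continuous.continuousOn
  obtain ⟨B, hB⟩ := hCc.exists_bound_of_continuousOn hf.1.continuous.continuousOn
  have hint : IntegrableOn (fun σ => ‖up σ‖ ^ 2) (Ioi 0) := by
    refine integrableOn_Ioi_of_intervalIntegral_norm_bounded
      ((‖um 0‖ ^ 2 / 2 + f (x 0) + B) / c) 0 (b := fun t : ℝ => t) (l := atTop)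
      (fun t => ?_) tendsto_id ?_
    · rcases le_or_gt 0 t with ht | ht
      · exact (intervalIntegrable_iff_integrableOn_Ioc_of_le ht).1
          (h.intervalIntegrable_normSq le_rfl ht)
      · rw [Ioc_eq_empty (not_lt.2 ht.le)]
        exact integrableOn_empty
    · filter_upwards [eventually_ge_atTop 0] with t ht
      have h1 := h.energy_le_initial hε hε1 hf hg hC hc ht
      have h2 := (abs_le.1 (hB _ (hC t ht))).1
      rw [le_div_iff₀ hc0]
      simp only [norm_pow, norm_norm]
      have : 0 ≤ ‖up t‖ ^ 2 := by positivity
      linarith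
  have hlim := intervalIntegral_tendsto_integral_Ioi 0 hint tendsto_id
  have hlim' : Tendsto (fun t : ℝ => ∫ σ in (0 : ℝ)..(t - 1), ‖up σ‖ ^ 2) atTop _ :=
    hlim.comp (tendsto_atTop_add_const_right atTop (-1) tendsto_id)
  have hq : Tendsto (fun t : ℝ => ∫ σ in (t - 1)..t, ‖up σ‖ ^ 2) atTop (𝓝 0) := by
    have := hlim.sub hlim'
    rw [sub_self] at this
    refine this.congr' ?_
    filter_upwards [eventually_ge_atTop 1] with t ht
    rw [id, intervalIntegral.integral_interval_sub_left
      (h.intervalIntegrable_normSq le_rfl (by linarith))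
      (h.intervalIntegrable_normSq le_rfl (by linarith))]
  rw [tendsto_zero_iff_norm_tendsto_zero]
  refine Metric.tendsto_nhds.2 fun e he => ?_
  have hη : 0 < e ^ 2 / 4 := by positivity
  have hq' := hq.const_mul (1 + M ^ 2 / (2 * (e ^ 2 / 4)))
  rw [mul_zero] at hq'
  filter_upwards [eventually_ge_atTop 1, hq'.eventually_lt_const (show 0 < e ^ 2 / 2 by positivity)]
    with t ht hqt
  have := h.normSq_le_of_energy hε hε1 hf hg hC hc0 hc hM hη ht
  rw [dist_zero_right, norm_norm]
  exact lt_of_pow_lt_pow_left₀ 2 he.le (by linarith)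

/-- If the velocity vanishes asymptotically, the feasible cluster points of the position are
stationary. -/
theorem mem_stationarySet_of_mapClusterPt (h : IsTrajectory f g α β δ ε x um up) (hβ : 0 ≤ β)
    (hδ : 0 < δ) (hf : OneSmooth f) (hg : ∀ i, ContDiff ℝ 1 (g i)) (hMF : MFCQ g)
    (hup : Tendsto up atTop (𝓝 0)) (hp : p ∈ feasibleSet g) (hcl : MapClusterPt p atTop x) :
    p ∈ stationarySet f g := by
  refine (mem_stationarySet_or_exists_descent hMF hp).resolve_right ?_
  rintro ⟨v, hfv, hgv⟩
  set κ := -inner ℝ (gradient f p) v with hκ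
  have hκ0 : 0 < κ := neg_pos.2 hfv
  have hev : ∀ᶠ y in 𝓝 p, inner ℝ (gradient f y) v < -κ / 2 ∧
      ∀ i, i ∈ activeSet g y → 0 < inner ℝ (gradient (g i) y) v := by
    refine Eventually.and ?_ (eventually_all.2 fun i => ?_)
    · have : Continuous fun y => inner ℝ (gradient f y) v := hf.2.continuous.inner continuous_const
      exact this.continuousAt.eventually_lt_const (by linarith)
    · by_cases hi : i ∈ activeSet g p
      · have : Continuous fun y => inner ℝ (gradient (g i) y) v :=
          (continuous_gradient_of_contDiff (hg i)).inner continuous_const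
        filter_upwards [this.continuousAt.eventually_const_lt (hgv i hi)] with y hy _ using hy
      · rw [mem_activeSet, not_le] at hi
        filter_upwards [(hg i).continuous.continuousAt.eventually_const_lt hi] with y hy hy'
        exact absurd (mem_activeSet.1 hy') (not_le.2 hy)
  obtain ⟨ρ, hρ, hball⟩ := Metric.eventually_nhds_iff.1 hev
  -- The terms `2 * δ` and `β` pay for damping and for the shift in `∇f`, leaving acceleration at
  -- least `κ / 4` along `v`. The `2` bounds the total change of `⟪v, up⟫` by `κ / 8`, and the `1`
  -- makes `K` positive. The bound `η ≤ ρ / 2` keeps `x` in the ball for unit time.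
  set K := (2 * δ + β + 2) * ‖v‖ + 1 with hK
  have hK0 : 0 < K := by positivity
  set η := min (ρ / 2) (κ / 8 / K) with hηdef
  have hη : 0 < η := by positivity
  have hηK : η * K ≤ κ / 8 := by
    have : η ≤ κ / 8 / K := min_le_right _ _
    rwa [le_div_iff₀ hK0] at this
  have hηv : 0 ≤ η * ‖v‖ := by positivity
  have hηK' : 2 * δ * (η * ‖v‖) + β * (η * ‖v‖) + 2 * (η * ‖v‖) + η ≤ κ / 8 := by
    calc _ = η * K := by rw [hK]; ring
      _ ≤ _ := hηK
  obtain ⟨T, hT⟩ := Metric.tendsto_atTop.1 hup η hη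
  have hfreq := hcl.frequently (Metric.ball_mem_nhds p (show 0 < ρ / 2 by linarith))
  obtain ⟨t₀, ht₀, ht₁⟩ := (hfreq.and_eventually
    ((eventually_ge_atTop T).and (eventually_ge_atTop 0))).exists
  obtain ⟨htT, ht0⟩ := ht₁
  have hu : ∀ t, t₀ ≤ t → ‖up t‖ ≤ η := by
    intro t ht
    have := hT t (htT.trans ht)
    rw [dist_zero_right] at this
    exact this.le
  have hxball : ∀ t ∈ Icc t₀ (t₀ + 1), dist (x t) p < ρ := by
    intro t ht
    have h1 : ‖x t - x t₀‖ ≤ η * |t - t₀| := by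
      rw [h.sub_eq ht0 (ht0.trans ht.1)]
      refine intervalIntegral.norm_integral_le_of_norm_le_const fun σ hσ => ?_
      rw [uIoc_of_le ht.1] at hσ
      exact hu σ hσ.1.le
    have h2 : |t - t₀| ≤ 1 := by rw [abs_of_nonneg (by linarith [ht.1])]; linarith [ht.2]
    have h3 : η * |t - t₀| ≤ η * 1 := by gcongr
    have h4 : η ≤ ρ / 2 := min_le_left _ _
    have h5 : dist (x t₀) p < ρ / 2 := ht₀
    rw [← dist_eq_norm] at h1
    linarith [dist_triangle (x t) (x t₀) p]
  obtain ⟨-, a, l, L, hbv, -, -, hode, hcomp, hjump, himp⟩ := h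
  have hsub : Ioc t₀ (t₀ + 1) ⊆ Ici 0 := fun σ hσ => ht0.trans hσ.1.le
  have hge := hbv.mul_le_inner_sub (v := v) (κ := κ / 4) ht0 (show t₀ ≤ t₀ + 1 by linarith) ?_ ?_
  · have h1 := real_inner_le_norm v (up (t₀ + 1) - up t₀)
    have h2 : ‖up (t₀ + 1) - up t₀‖ ≤ 2 * η := by
      refine (norm_sub_le _ _).trans ?_
      linarith [hu t₀ le_rfl, hu (t₀ + 1) (by linarith)]
    have h3 : ‖v‖ * ‖up (t₀ + 1) - up t₀‖ ≤ ‖v‖ * (2 * η) := by gcongr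
    have h4 : 0 ≤ 2 * δ * (η * ‖v‖) := by positivity
    have h5 : 0 ≤ β * (η * ‖v‖) := by positivity
    linarith
  · filter_upwards [ae_restrict_of_ae_restrict_of_subset hsub hcomp,
      ae_restrict_of_ae_restrict_of_subset hsub hode,
      ae_restrict_mem measurableSet_Ioc] with t h1 h2 h3
    obtain ⟨hb1, hb2⟩ := hball (hxball t ⟨h3.1.le, h3.2⟩)
    have h4 : 0 ≤ inner ℝ (∑ i ∈ activeSet g (x t), l i t • gradient (g i) (x t)) v := by
      rw [sum_inner]
      refine Finset.sum_nonneg fun i hi => ?_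
      rw [real_inner_smul_left]
      exact mul_nonneg (mem_normalCone_Iic_zero.1 (h1 i hi)).1 (hb2 i hi).le
    rw [← h2, inner_add_left, inner_add_left, real_inner_smul_left] at h4
    have hut := hu t h3.1.le
    have h5 : inner ℝ (up t) v ≤ η * ‖v‖ :=
      (real_inner_le_norm _ _).trans (by gcongr)
    have h6 : 2 * δ * inner ℝ (up t) v ≤ 2 * δ * (η * ‖v‖) := by gcongr
    have h7 : inner ℝ (gradient f (x t + β • up t) - gradient f (x t)) v ≤ β * (η * ‖v‖) := by
      refine (real_inner_le_norm _ _).trans ?_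
      have h8 : ‖gradient f (x t + β • up t) - gradient f (x t)‖ ≤ β * ‖up t‖ := by
        have := hf.2.dist_le_mul (x t + β • up t) (x t)
        simpa [dist_eq_norm, norm_smul, abs_of_nonneg hβ] using this
      calc _ ≤ β * ‖up t‖ * ‖v‖ := by gcongr
        _ ≤ β * η * ‖v‖ := by gcongr
        _ = _ := by ring
    rw [inner_sub_left] at h7
    rw [real_inner_comm]
    linarith
  · intro t ht
    obtain ⟨-, hb2⟩ := hball (hxball t ⟨ht.1.le, ht.2⟩)
    rw [hjump t (hsub ht), inner_sum]
    refine Finset.sum_nonneg fun i hi => ?_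
    rw [real_inner_smul_right, real_inner_comm]
    exact mul_nonneg (mem_normalCone_Iic_zero.1 (himp t (hsub ht) i hi)).1 (hb2 i hi).le

theorem tendsto_infEDist_stationarySet (h : IsTrajectory f g α β δ ε x um up) (hβ : 0 ≤ β)
    (hδ : 0 < δ) (hf : OneSmooth f) (hg : ∀ i, ContDiff ℝ 1 (g i)) (hMF : MFCQ g)
    (hCc : IsCompact (feasibleSet g)) (hC : ∀ t, 0 ≤ t → x t ∈ feasibleSet g)
    (hup : Tendsto up atTop (𝓝 0)) :
    Tendsto (fun t => Metric.infEDist (x t) (stationarySet f g)) atTop (𝓝 0) := by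
  rw [ENNReal.tendsto_nhds_zero]
  intro e he
  by_contra hne
  rw [not_eventually] at hne
  -- Compactness gives a cluster point along the bad times; it is stationary, a contradiction. As
  -- `infEDist` to the empty set is `⊤`, this also covers nonemptiness of the stationary set.
  set A : Set ℝ := {t | ¬ Metric.infEDist (x t) (stationarySet f g) ≤ e} with hA
  have : NeBot (atTop ⊓ 𝓟 A) := frequently_iff_neBot.1 hne
  have hev : ∀ᶠ t in atTop ⊓ 𝓟 A, x t ∈ feasibleSet g := by
    filter_upwards [mem_inf_of_left (eventually_ge_atTop 0)] with t ht using hC t ht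
  obtain ⟨p, hpC, hcl⟩ := hCc.exists_mapClusterPt (f := atTop ⊓ 𝓟 A) (u := x)
    (tendsto_principal.2 hev)
  have hps := h.mem_stationarySet_of_mapClusterPt hβ hδ hf hg hMF hup hpC
    (hcl.mono inf_le_left)
  obtain ⟨t, ht, htA⟩ := ((hcl.frequently (Metric.eball_mem_nhds p he)).and_eventually
    (mem_inf_of_right (mem_principal_self A))).exists
  exact htA ((Metric.infEDist_le_edist_of_mem hps).trans (le_of_lt ht))

end IsTrajectory

/-! ### Stability of strict and isolated minima -/

theorem IsStrictLocalMin.isLocalMinOn (h : IsStrictLocalMin f g p) :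
    IsLocalMinOn f (feasibleSet g) p := by
  filter_upwards [h.2] with y hy
  rcases eq_or_ne y p with rfl | hne
  · exact le_rfl
  · exact (hy hne).le

/-- A nearby feasible point with the same value of `f` would itself be a local minimum, hence
stationary, hence equal to `p`. -/
theorem IsIsolatedLocalMin.isStrictLocalMin (hf : Differentiable ℝ f)
    (hg : ∀ i, ContDiff ℝ 1 (g i)) (hMF : MFCQ g) (h : IsIsolatedLocalMin f g p) :
    IsStrictLocalMin f g p := by
  obtain ⟨hp, hmin, hiso⟩ := h
  refine ⟨hp, ?_⟩
  have hmin' : ∀ᶠ y in 𝓝 p, y ∈ feasibleSet g → f p ≤ f y := eventually_nhdsWithin_iff.1 hmin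
  rw [eventually_nhdsWithin_iff]
  filter_upwards [hiso, hmin'.eventually_nhds] with y hy hy' hyC hne
  refine (hy'.self_of_nhds hyC).lt_of_ne fun heq => hne (hy ?_)
  refine mem_stationarySet_of_isLocalMinOn hf hg hMF hyC ?_
  refine eventually_nhdsWithin_iff.2 ?_
  filter_upwards [hy'] with z hz hzC
  rw [← heq]
  exact hz hzC

theorem IsStrictLocalMin.lyapunovStable (hα : 0 < α) (hβ : 0 ≤ β) (hδ : 0 < δ) (hε : 0 ≤ ε)
    (hε1 : ε < 1) (hf : OneSmooth f) (hg : ∀ i, ContDiff ℝ 1 (g i))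
    (hCc : IsCompact (feasibleSet g)) (hfδ : ConvexOn ℝ univ f ∨ 0 < 2 * δ - β)
    (hmin : IsStrictLocalMin f g p) : LyapunovStable f g α β δ ε p := by
  intro r hr
  obtain ⟨c, hc0, hc⟩ := exists_damping hβ hδ hf hfδ
  obtain ⟨ρ, hρ, hball⟩ := Metric.eventually_nhds_iff.1 (eventually_nhdsWithin_iff.1 hmin.2)
  set r₁ := min (r / 2) (ρ / 2) with hr₁
  have hr₁0 : 0 < r₁ := by positivity
  have hr₁ρ : r₁ < ρ := (min_le_right _ _).trans_lt (by linarith)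
  have hr₁r : r₁ < r := (min_le_left _ _).trans_lt (by linarith)
  -- The energy barrier: by continuity, leaving the ball means crossing this compact set, which
  -- costs potential `κ`.
  obtain ⟨κ, hκ, hsph⟩ : ∃ κ > 0, ∀ y ∈ feasibleSet g ∩ Metric.sphere p r₁, f p + κ ≤ f y := by
    rcases (feasibleSet g ∩ Metric.sphere p r₁).eq_empty_or_nonempty with he | hne
    · exact ⟨1, one_pos, fun y hy => by simp [he] at hy⟩
    · obtain ⟨z, hz, hzmin⟩ := (hCc.inter_right Metric.isClosed_sphere).exists_isMinOn hne
        hf.1.continuous.continuousOn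
      refine ⟨f z - f p, sub_pos.2 (hball ?_ hz.1 ?_), fun y hy => by linarith [isMinOn_iff.1 hzmin y hy]⟩
      · rw [Metric.mem_sphere.1 hz.2]; exact hr₁ρ
      · exact Metric.ne_of_mem_sphere hz.2 hr₁0.ne'
  -- The second bound turns an energy excess below `κ'` into `‖up‖ ≤ r / 2`.
  set κ' := min κ (r ^ 2 / 8) with hκ'
  have hκ'0 : 0 < κ' := by positivity
  obtain ⟨d₁, hd₁, hd₁f⟩ := Metric.eventually_nhds_iff.1
    (hf.1.continuous.continuousAt.eventually_lt_const (show f p < f p + κ' / 2 by linarith))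
  -- The bound `1` gives `‖um 0‖ ^ 2 ≤ ‖um 0‖`, so the kinetic and potential excesses are each below
  -- `κ' / 2`.
  refine ⟨min (min d₁ r₁) (min 1 κ'), by positivity, fun x um up htr h0 hx0 hu0 t ht => ?_⟩
  have hx0d : ‖x 0 - p‖ < d₁ := hx0.trans_le ((min_le_left _ _).trans (min_le_left _ _))
  have hx0r : ‖x 0 - p‖ < r₁ := hx0.trans_le ((min_le_left _ _).trans (min_le_right _ _))
  have hu1 : ‖um 0‖ < 1 := hu0.trans_le ((min_le_right _ _).trans (min_le_left _ _))
  have huκ : ‖um 0‖ < κ' := hu0.trans_le ((min_le_right _ _).trans (min_le_right _ _))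
  have hur : ‖um 0‖ < r := (hu0.trans_le ((min_le_left _ _).trans (min_le_right _ _))).trans hr₁r
  have hC := fun t ht => htr.mem_feasibleSet hα hε hg h0 (t := t) ht
  have hE0 : ‖um 0‖ ^ 2 / 2 + f (x 0) < f p + κ' := by
    have h1 : f (x 0) < f p + κ' / 2 := hd₁f (y := x 0) (by rwa [dist_eq_norm])
    have h2 : ‖um 0‖ ^ 2 ≤ ‖um 0‖ := pow_le_of_le_one (norm_nonneg _) hu1.le two_ne_zero
    linarith
  have hE : ∀ t, 0 ≤ t → ‖up t‖ ^ 2 / 2 + f (x t) < f p + κ' := by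
    intro t ht
    have h1 := htr.energy_le_initial hε hε1 hf hg hC hc ht
    have h2 : 0 ≤ c * ∫ σ in (0 : ℝ)..t, ‖up σ‖ ^ 2 :=
      mul_nonneg hc0.le (intervalIntegral.integral_nonneg ht fun σ _ => by positivity)
    linarith
  have hx : ∀ t, 0 ≤ t → ‖x t - p‖ < r₁ := by
    intro t ht
    by_contra! hge
    have hcont : ContinuousOn (fun s => ‖x s - p‖) (Icc 0 t) :=
      ((htr.continuousOn_Icc ht).sub continuousOn_const).norm
    obtain ⟨s, hs, hs'⟩ := intermediate_value_Icc ht hcont ⟨hx0r.le, hge⟩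
    have h1 := hsph (x s) ⟨hC s hs.1, by rw [Metric.mem_sphere, dist_eq_norm]; exact hs'⟩
    have h2 := hE s hs.1
    have h3 : κ' ≤ κ := min_le_left _ _
    have : 0 ≤ ‖up s‖ ^ 2 := by positivity
    linarith
  have hup : ∀ t, 0 ≤ t → ‖up t‖ ≤ r / 2 := by
    intro t ht
    have h1 : f p ≤ f (x t) := by
      rcases eq_or_ne (x t) p with he | hne
      · rw [he]
      · refine (hball ?_ (hC t ht) hne).le
        rw [dist_eq_norm]; exact (hx t ht).trans hr₁ρ
    have h2 := hE t ht
    have h3 : κ' ≤ r ^ 2 / 8 := min_le_right _ _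
    refine le_of_sq_le_sq ?_ (by positivity)
    rw [div_pow]
    linarith
  refine ⟨(hx t ht).trans hr₁r, ?_, (hup t ht).trans_lt (by linarith)⟩
  rcases ht.eq_or_lt with rfl | hpos
  · exact hur
  · exact (htr.norm_um_le le_rfl hpos fun σ hσ => hup σ hσ.1.le).trans_lt (by linarith)

end AccFlow

open AccFlow
theorem theorem2 {n m : ℕ} (f : Vec n → ℝ) (g : Fin m → Vec n → ℝ) (α β δ ε : ℝ)
    (hα : 0 < α) (hβ : 0 ≤ β) (hδ : 0 < δ) (hε : 0 ≤ ε) (hε1 : ε < 1)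
    (hf : OneSmooth f) (hg : ∀ i, ContDiff ℝ 1 (g i))
    (hC : IsCompact (feasibleSet g)) (hMF : MFCQ g)
    (hfδ : ConvexOn ℝ univ f ∨ 0 < 2 * δ - β) :
    (∀ x um up : ℝ → Vec n, IsTrajectory f g α β δ ε x um up → x 0 ∈ feasibleSet g →
      Tendsto (fun t => Metric.infEDist (x t) (stationarySet f g)) atTop (𝓝 0) ∧
        Tendsto um atTop (𝓝 0) ∧ Tendsto up atTop (𝓝 0)) ∧
    (∀ p, IsIsolatedLocalMin f g p → AsymptoticallyStable f g α β δ ε p) ∧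
    (∀ p, IsStrictLocalMin f g p →
      IsEquilibrium f g α β δ ε p ∧ LyapunovStable f g α β δ ε p) := by
  have hconv : ∀ x um up : ℝ → Vec n, IsTrajectory f g α β δ ε x um up → x 0 ∈ feasibleSet g →
      Tendsto (fun t => Metric.infEDist (x t) (stationarySet f g)) atTop (𝓝 0) ∧
        Tendsto um atTop (𝓝 0) ∧ Tendsto up atTop (𝓝 0) := by
    intro x um up h h0
    obtain ⟨c, hc0, hc⟩ := exists_damping hβ hδ hf hfδ
    have hfeas := fun t ht => h.mem_feasibleSet hα hε hg h0 (t := t) ht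
    have hup := h.tendsto_up_zero hε hε1 hf hg hC hfeas hc0 hc
    exact ⟨h.tendsto_infEDist_stationarySet hβ hδ hf hg hMF hC hfeas hup,
      h.tendsto_um_zero hup, hup⟩
  have hstrict : ∀ p, IsStrictLocalMin f g p →
      IsEquilibrium f g α β δ ε p ∧ LyapunovStable f g α β δ ε p := fun p hp =>
    ⟨isEquilibrium_of_mem_stationarySet
      (mem_stationarySet_of_isLocalMinOn hf.1 hg hMF hp.1 hp.isLocalMinOn),
      hp.lyapunovStable hα hβ hδ hε hε1 hf hg hC hfδ⟩
  refine ⟨hconv, fun p hp => ?_, hstrict⟩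
  obtain ⟨heq, hstab⟩ := hstrict p (hp.isStrictLocalMin hf.1 hg hMF)
  refine ⟨heq, hstab, ?_⟩
  obtain ⟨ρ, hρ, hball⟩ := Metric.eventually_nhds_iff.1 hp.2.2
  -- With `x t` within `ρ / 2` of `p`, any stationary point within `ρ / 2` of `x t` lies in the
  -- isolating ball and is `p`.
  obtain ⟨d, hd, hstay⟩ := hstab (ρ / 2) (by linarith)
  refine ⟨d, hd, fun x um up h h0 hx0 hu0 => ?_⟩
  obtain ⟨h1, h2, h3⟩ := hconv x um up h h0
  refine ⟨Metric.tendsto_nhds.2 fun e he => ?_, h2, h3⟩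
  have he' : (0 : ENNReal) < ENNReal.ofReal (min e (ρ / 2)) :=
    ENNReal.ofReal_pos.2 (lt_min he (by linarith))
  filter_upwards [h1.eventually_lt_const he', eventually_ge_atTop 0] with t ht ht0
  obtain ⟨y, hy, hxy⟩ := Metric.infEDist_lt_iff.1 ht
  rw [edist_lt_ofReal, lt_min_iff] at hxy
  have hxp := (hstay x um up h h0 hx0 hu0 t ht0).1
  rw [← dist_eq_norm] at hxp
  have hyp : y = p := hball (by linarith [dist_triangle_left y p (x t), hxy.2]) hy
  rw [← hyp]
  exact hxy.1
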